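/- Let $X$ and $D$ be (real or complex) Banach spaces, $D$ injecting continuously, densely and compactly into $X$; let $1<p<\infty$ and let $I=(a,b)$ be a bounded open interval, $-\infty<a<b<\infty$. For an open interval $J=(c,d)$, $-\infty<c<d\le\infty$, let $MR^p(J)=L^p(J;D)\cap W^{1,p}(J;X)$, with norm $$\|u\|_{MR^p(J)}=\big(\|u\|_{L^p(J;X)}^p+\|u\|_{L^p(J;D)}^p+w_J^p\,\|\tfrac{d}{dt}u\|_{L^p(J;X)}^p\big)^{1/p},$$ where $w_J=|J|$ if $d<\infty$ and $w_J=1$ if $d=\infty$. Say that $A:J\to\mathcal L(D;X)$ is in $L^\infty(J;\mathcal L(D;X))$ if for each $x\in D$ the map $A(\cdot)x:J\to X$ is Bochner measurable and essentially bounded. Such an $A$ is *maximally regular on $J$*, written $A\in\mathcal{MR}_p(J)$, if for every $t\in J$ the graph norm $\|x\|_X+\|A(t)x\|_X$ is equivalent to $\|x\|_D$ on $D$, and for every $f\in L^p(J;X)$ there is a unique $v\in MR^p(J)$ with $$\tfrac{d}{dt}v(t)+A(t)v(t)=f(t)\ \text{ for a.e. }t\in J,\qquad v(c)=0,$$ and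 there is $K\ge0$, independent of $f$, such that $\|v\|_{MR^p(J)}\le K\|f\|_{L^p(J;X)}$. For an autonomous operator $A\in\mathcal L(D;X)$ the same property is written $A\in mr_p(J)$, and $[A]_{mr_p(J)}$ denotes the infimum of the admissible $K$. A map $A:[a,b]\to\mathcal L(D;X)$ such that $A(\cdot)x$ is Bochner measurable for each $x \in D$ is *relatively continuous* if for every $\epsilon>0$ there are $\delta>0$ and $\eta\ge0$ such that $$\|A(t)x-A(s)x\|_X\le\epsilon\|x\|_D+\eta\|x\|_X\quad\text{for all }x\in D\text{ and all }t,s\in[a,b]\text{ with }|t-s|\le\delta .$$ A family of relatively continuous maps is *relatively equicontinuous* if, for every $\epsilon$, the numbers $\delta,\eta$ can be chosen the same for all its members. Let $\Lambda$ be a metric space, $\mathcal O\subset\Lambda$ open, and for each $\lambda\in\Lambda$ let $A_\lambda:[a,b]\to\mathcal L(D;X)$. Assume $(A_\Lambda)$: 1. for every $t\in[a,b]$: $A_\lambda(t)\in mr_p(0,\infty)$ for all $\lambda\in\mathcal O$, and $\sup_{\lambda\in\mathcal O}[A_\lambda(t)]_{mr_p(I)}<\infty$; 2. the family $\{A_\lambda\}_{\lambda\in\mathcal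 O}$ consists of relatively continuous maps and is relatively equicontinuous; 3. for every $t\in[a,b]$ the family $\{A_\lambda(t)\}_{\lambda\in\mathcal O}$ is bounded in $\mathcal L(D;X)$. Let $\bar\lambda\in\overline{\mathcal O}$ be such that $\|A_\lambda(t)-A_{\bar\lambda}(t)\|_{\mathcal L(D;X)}\to0$ as $\lambda\to\bar\lambda$ in $\mathcal O$, for every $t\in[a,b]$. Then $A_\lambda\in\mathcal{MR}_p(I)$ for all $\lambda\in\mathcal O$, and $A_{\bar\lambda}\in\mathcal{MR}_p(I)$. Moreover, let $f_\lambda\in L^p(I;X)$ for $\lambda\in\mathcal O\cup\{\bar\lambda\}$, and let $v_\lambda\in MR^p(I)$ be the solution of $\frac{d}{dt}v_\lambda+A_\lambda v_\lambda=f_\lambda$ on $I$, $v_\lambda(a)=0$. If $f_\lambda\to f_{\bar\lambda}$ strongly in $L^p(I;X)$ as $\lambda\to\bar\lambda$ in $\mathcal O$, then $v_\lambda\to v_{\bar\lambda}$ strongly in $MR^p(I)$ as $\lambda\to\bar\lambda$ in $\mathcal O$. -/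

import Mathlib

open MeasureTheory Filter Topology Set
open scoped ENNReal NNReal

namespace MaxReg

section Spaces

variable {𝕜 D X : Type*} [RCLike 𝕜]
  [NormedAddCommGroup D] [NormedSpace 𝕜 D]
  [NormedAddCommGroup X] [NormedSpace ℝ X] [NormedSpace 𝕜 X]

/-- `w` is the weak derivative on the open set `I ⊆ ℝ` of the `X`-valued function `u`:
both are locally integrable on `I` and `- ∫_I φ' u = ∫_I φ w` for every real test function
`φ ∈ C_c^∞(I)`. -/
structure HasWeakDeriv (I : Set ℝ) (u w : ℝ → X) : Prop where
  locInt : LocallyIntegrableOn u I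
  locInt_deriv : LocallyIntegrableOn w I
  integral_eq : ∀ φ : ℝ → ℝ, ContDiff ℝ ((⊤ : ℕ∞) : WithTop ℕ∞) φ → HasCompactSupport φ →
    tsupport φ ⊆ I → -∫ t in I, deriv φ t • u t = ∫ t in I, φ t • w t

/-- `u` belongs to the maximal regularity space `MR^p(I) = L^p(I; D) ∩ W^{1,p}(I; X)`, with
weak derivative `w ∈ L^p(I; X)`. The inclusion of `D` in `X` is the map `ι`. -/
structure MemMR (I : Set ℝ) (p : ℝ) (ι : D →L[𝕜] X) (u : ℝ → D) (w : ℝ → X) : Prop where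
  memLp : MemLp u (ENNReal.ofReal p) (volume.restrict I)
  memLp_deriv : MemLp w (ENNReal.ofReal p) (volume.restrict I)
  weakDeriv : HasWeakDeriv I (fun t => ι (u t)) w

/-- The weight of the time derivative in the norm of `MR^p(I)`: the length of `I` if `I` is
bounded, and `1` if `I` is a half-line. -/
noncomputable def timeWeight (I : Set ℝ) : ℝ≥0∞ :=
  open Classical in if volume I = ⊤ then 1 else volume I

/-- The norm of `MR^p(I)`,
`(‖u‖_{L^p(I;X)}^p + ‖u‖_{L^p(I;D)}^p + |I|^p ‖u'‖_{L^p(I;X)}^p)^{1/p}`, without the factor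
`|I|^p` if `I` is unbounded. As the weak derivative is unique almost everywhere, the infimum is
over a single value if `u ∈ MR^p(I)`; it is `⊤` if `u ∉ MR^p(I)`. -/
noncomputable def mrNorm (I : Set ℝ) (p : ℝ) (ι : D →L[𝕜] X) (u : ℝ → D) : ℝ≥0∞ :=
  ⨅ (w : ℝ → X) (_ : MemMR I p ι u w),
    (eLpNorm (fun t => ι (u t)) (ENNReal.ofReal p) (volume.restrict I) ^ p
      + eLpNorm u (ENNReal.ofReal p) (volume.restrict I) ^ p
      + timeWeight I ^ p * eLpNorm w (ENNReal.ofReal p) (volume.restrict I) ^ p) ^ (1 / p)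

/-- `u(a) = x` for `u ∈ MR^p(I)`, where `a` is the left endpoint of `I`: the representative of `u`
that is continuous on the closure of `I`, with values in `X`, takes the value `x` at `a`. -/
def HasInitialValue (I : Set ℝ) (a : ℝ) (u : ℝ → X) (x : X) : Prop :=
  ∃ g : ℝ → X, ContinuousOn g (closure I) ∧ (∀ᵐ t ∂(volume.restrict I), g t = u t) ∧ g a = x

/-- `v ∈ MR^p(I)` solves `v'(t) + A(t) v(t) = f(t)` for almost every `t ∈ I`, with `v(a) = 0`. -/
def IsSolution (I : Set ℝ) (a p : ℝ) (ι : D →L[𝕜] X) (A : ℝ → D →L[𝕜] X)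
    (f : ℝ → X) (v : ℝ → D) : Prop :=
  (∃ w : ℝ → X, MemMR I p ι v w ∧ ∀ᵐ t ∂(volume.restrict I), w t + A t (v t) = f t) ∧
    HasInitialValue I a (fun t => ι (v t)) 0

/-- For every `f ∈ L^p(I; X)` the Cauchy problem `v' + A v = f`, `v(a) = 0` has a unique solution
`v` in `MR^p(I)` (up to equality almost everywhere), and `‖v‖_{MR^p(I)} ≤ K ‖f‖_{L^p(I;X)}`. -/
def SolvableWith (I : Set ℝ) (a p : ℝ) (ι : D →L[𝕜] X) (A : ℝ → D →L[𝕜] X) (K : ℝ≥0) : Prop :=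
  ∀ f : ℝ → X, MemLp f (ENNReal.ofReal p) (volume.restrict I) →
    ∃ v : ℝ → D, IsSolution I a p ι A f v ∧
      (∀ v' : ℝ → D, IsSolution I a p ι A f v' → v' =ᵐ[volume.restrict I] v) ∧
      mrNorm I p ι v ≤ K * eLpNorm f (ENNReal.ofReal p) (volume.restrict I)

/-- The graph norm `‖x‖_X + ‖A x‖_X` of `A` is equivalent to the norm of `D`. -/
def GraphNormEquiv (ι : D →L[𝕜] X) (A : D →L[𝕜] X) : Prop :=
  ∃ c C : ℝ, 0 < c ∧ 0 < C ∧ ∀ x : D, c * ‖x‖ ≤ ‖ι x‖ + ‖A x‖ ∧ ‖ι x‖ + ‖A x‖ ≤ C * ‖x‖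

/-- The autonomous operator `A ∈ L(D; X)` has the `L^p` maximal regularity property on `I`, an
open interval with left endpoint `a`. -/
def AutMaxReg (I : Set ℝ) (a p : ℝ) (ι : D →L[𝕜] X) (A : D →L[𝕜] X) : Prop :=
  GraphNormEquiv ι A ∧ ∃ K : ℝ≥0, SolvableWith I a p ι (fun _ => A) K

/-- The maximal regularity constant on `I` of the autonomous operator `A`: the infimum of the
admissible constants `K`. It is `⊤` if there is none. -/
noncomputable def autMRConst (I : Set ℝ) (a p : ℝ) (ι : D →L[𝕜] X) (A : D →L[𝕜] X) : ℝ≥0∞ :=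
  ⨅ (K : ℝ≥0) (_ : SolvableWith I a p ι (fun _ => A) K), (K : ℝ≥0∞)

/-- The nonautonomous operator `A` belongs to `L^∞(I; L(D; X))` and has the `L^p` maximal
regularity property on `I`, an open interval with left endpoint `a`. The first clause says that
`t ↦ A(t) x` is Bochner measurable and essentially bounded on `I`, for every `x ∈ D`. -/
def NonautMaxReg (I : Set ℝ) (a p : ℝ) (ι : D →L[𝕜] X) (A : ℝ → D →L[𝕜] X) : Prop :=
  (∀ x : D, MemLp (fun t => A t x) ⊤ (volume.restrict I)) ∧
    (∀ t ∈ I, GraphNormEquiv ι (A t)) ∧ ∃ K : ℝ≥0, SolvableWith I a p ι A K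

/-- `‖A(t) x - A(s) x‖_X ≤ ε ‖x‖_D + η ‖x‖_X` for all `x ∈ D` and all `t, s ∈ [a, b]` with
`|t - s| ≤ δ`. -/
def RelContEstimate (a b : ℝ) (ι : D →L[𝕜] X) (A : ℝ → D →L[𝕜] X) (ε δ η : ℝ) : Prop :=
  ∀ x : D, ∀ t ∈ Icc a b, ∀ s ∈ Icc a b, |t - s| ≤ δ →
    ‖A t x - A s x‖ ≤ ε * ‖x‖ + η * ‖ι x‖

/-- `A : [a, b] → L(D; X)` is strongly measurable and relatively continuous. -/
def RelCont (a b : ℝ) (ι : D →L[𝕜] X) (A : ℝ → D →L[𝕜] X) : Prop :=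
  (∀ x : D, AEStronglyMeasurable (fun t => A t x) (volume.restrict (Ioo a b))) ∧
    ∀ ε > 0, ∃ δ > 0, ∃ η ≥ 0, RelContEstimate a b ι A ε δ η

/-- The family `F` consists of relatively continuous operators on `[a, b]` and is relatively
equicontinuous: `δ` and `η` can be chosen independently of the member of the family. -/
def RelEquicont (a b : ℝ) (ι : D →L[𝕜] X) (F : Set (ℝ → D →L[𝕜] X)) : Prop :=
  (∀ A ∈ F, RelCont a b ι A) ∧
    ∀ ε > 0, ∃ δ > 0, ∃ η ≥ 0, ∀ A ∈ F, RelContEstimate a b ι A ε δ η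

/-- The assumption on the family `A_l`, `l ∈ O`, of nonautonomous operators on `[a, b]`:
pointwise autonomous maximal regularity on `(0, ∞)`, with maximal regularity constants on `(a, b)`
that are bounded in `l` for each `t`; relative equicontinuity; and pointwise boundedness. -/
structure FamilyAssumption {Λ : Type*} (a b p : ℝ) (ι : D →L[𝕜] X) (O : Set Λ)
    (A : Λ → ℝ → D →L[𝕜] X) : Prop where
  maxReg : ∀ t ∈ Icc a b, ∀ l ∈ O, AutMaxReg (Ioi 0) 0 p ι (A l t)
  const_bdd : ∀ t ∈ Icc a b, (⨆ l ∈ O, autMRConst (Ioo a b) a p ι (A l t)) < (⊤ : ℝ≥0∞)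
  equicont : RelEquicont a b ι (A '' O)
  bdd : ∀ t ∈ Icc a b, ∃ C : ℝ, ∀ l ∈ O, ‖A l t‖ ≤ C

end Spaces

end MaxReg

/-! On a bounded interval a function in MR^p with initial value 0 is the primitive of its weak
derivative, so the Cauchy problem can be written in integrated form (`MildSolution`), without trace
spaces. `MildSolvable` asks for existence and for an a priori bound in L^q(D) only: the equation
then bounds the derivative, and linearity gives uniqueness.

For fixed t the operators A_λ(t), λ ∈ O, have a common constant, and convergence in operator norm
carries this over to the limit parameter (`exists_mildSolvable_insert`). Now freeze the coefficients
at a point s. Near s, the difference A_λ(t)x - A_λ(s)x is bounded by ε‖x‖_D + η‖x‖_X. The first term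
is small through ε. The second is small on short intervals, because a function starting from 0 is
bounded in L^q(X) by the length of the interval times the norm of its derivative. A contraction
argument (`MildSolvable.perturb`) therefore solves the nonautonomous problem on short intervals,
whose length and constants do not depend on λ. By compactness finitely many such intervals cover [a,
b], and `MildSolvable.glue` joins them: reflecting the solution at the junction continues it to the
right, and the remaining correction has initial value 0. Hence all λ, the limit included, share one
solvability constant K and one bound M on the operator norms.

For the convergence, v_λ - v_λ̄ solves the problem for A_λ with right-hand side f_λ - f_λ̄ - (A_λ -
A_λ̄)v_λ̄. Since v_λ̄ is fixed, the last term tends to 0 in L^p by dominated convergence, and the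
uniform estimate concludes. -/

namespace MaxReg

/-! ### Weak derivatives and primitives on a bounded interval -/

section WeakDerivative

variable {X : Type*} [NormedAddCommGroup X] [NormedSpace ℝ X]

/-- Integration by parts for a primitive of an integrable function. -/
theorem neg_integral_deriv_smul_primitive [CompleteSpace X] {a b : ℝ} {w : ℝ → X}
    (hw : IntegrableOn w (Ioo a b)) {φ : ℝ → ℝ} (hφ : ContDiff ℝ 1 φ) (hb : φ b = 0) :
    -∫ t in Ioo a b, deriv φ t • (∫ s in a..t, w s) = ∫ t in Ioo a b, φ t • w t := by
  have hφ' : Continuous (deriv φ) := hφ.continuous_deriv le_rfl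
  have hφi : IntegrableOn (deriv φ) (Ioo a b) :=
    (hφ'.continuousOn.integrableOn_Icc (a := a) (b := b)).mono_set Ioo_subset_Icc_self
  -- Fubini on the triangle s ≤ t for φ'(t) w(s): integrating in t first leaves φ(b) - φ(s) = -φ(s).
  -- There is no boundary term at a, since the primitive of w vanishes there.
  have hms : MeasurableSet {z : ℝ × ℝ | z.2 ≤ z.1} :=
    measurableSet_le measurable_snd measurable_fst
  have hint : Integrable (Function.uncurry fun t s =>
      {z : ℝ × ℝ | z.2 ≤ z.1}.indicator (fun z => deriv φ z.1 • w z.2) (t, s))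
      ((volume.restrict (Ioo a b)).prod (volume.restrict (Ioo a b))) :=
    (Integrable.smul_prod hφi hw).indicator hms
  have h1 : ∫ t in Ioo a b, deriv φ t • (∫ s in a..t, w s) =
      ∫ t in Ioo a b, ∫ s in Ioo a b,
        {z : ℝ × ℝ | z.2 ≤ z.1}.indicator (fun z => deriv φ z.1 • w z.2) (t, s) := by
    refine setIntegral_congr_fun measurableSet_Ioo fun t ht => ?_
    have : (fun s => {z : ℝ × ℝ | z.2 ≤ z.1}.indicator (fun z => deriv φ z.1 • w z.2) (t, s)) =
        (Iic t).indicator fun s => deriv φ t • w s := by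
      ext s; simp [indicator]
    simp only [this]
    rw [setIntegral_indicator measurableSet_Iic, integral_smul,
      intervalIntegral.integral_of_le ht.1.le]
    congr 3
    ext s
    simp only [mem_Ioc, mem_inter_iff, mem_Ioo, mem_Iic]
    exact ⟨fun h => ⟨⟨h.1, h.2.trans_lt ht.2⟩, h.2⟩, fun h => ⟨h.1.1, h.2⟩⟩
  rw [h1, integral_integral_swap hint, ← integral_neg]
  refine setIntegral_congr_fun measurableSet_Ioo fun s hs => ?_
  have : (fun t => {z : ℝ × ℝ | z.2 ≤ z.1}.indicator (fun z => deriv φ z.1 • w z.2) (t, s)) =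
      (Ici s).indicator fun t => deriv φ t • w s := by
    ext t; simp [indicator]
  simp only [this]
  have hset : Ioo a b ∩ Ici s = Ico s b := by
    ext t
    simp only [mem_Ico, mem_inter_iff, mem_Ioo, mem_Ici]
    exact ⟨fun h => ⟨h.2, h.1.2⟩, fun h => ⟨⟨hs.1.trans_le h.1, h.2⟩, h.1⟩⟩
  rw [setIntegral_indicator measurableSet_Ici, hset, integral_smul_const,
    integral_Ico_eq_integral_Ioo, ← integral_Ioc_eq_integral_Ioo,
    ← intervalIntegral.integral_of_le hs.2.le,
    intervalIntegral.integral_deriv_eq_sub (fun x _ => (hφ.differentiable one_ne_zero) x)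
      (hφ'.intervalIntegrable _ _), hb]
  simp

/-- A smooth function with compact support in an interval and vanishing integral has a smooth
primitive with compact support in that interval. -/
theorem exists_smooth_primitive {a b : ℝ} {θ : ℝ → ℝ}
    (hθ : ContDiff ℝ ((⊤ : ℕ∞) : WithTop ℕ∞) θ) (hc : HasCompactSupport θ)
    (hs : tsupport θ ⊆ Ioo a b) (h0 : ∫ t, θ t = 0) :
    ∃ φ : ℝ → ℝ, ContDiff ℝ ((⊤ : ℕ∞) : WithTop ℕ∞) φ ∧ HasCompactSupport φ ∧
      tsupport φ ⊆ Ioo a b ∧ deriv φ = θ := by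
  rcases (tsupport θ).eq_empty_or_nonempty with he | hne
  · refine ⟨0, contDiff_const, HasCompactSupport.zero, by simp, ?_⟩
    rw [tsupport_eq_empty_iff] at he
    rw [he]; ext; simp
  -- The extreme points α, β of the support lie in the open interval. Left of α the primitive is 0;
  -- right of β it is the total integral, which is 0 by `h0`.
  obtain ⟨α, hα, hαm⟩ := hc.exists_isMinOn hne continuousOn_id
  obtain ⟨β, hβ, hβm⟩ := hc.exists_isMaxOn hne continuousOn_id
  have hsub : tsupport θ ⊆ Icc α β := fun t ht => ⟨hαm ht, hβm ht⟩
  have hz : ∀ t, t ∉ Icc α β → θ t = 0 := fun t ht =>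
    image_eq_zero_of_notMem_tsupport fun h => ht (hsub h)
  have hd : ∀ t, HasDerivAt (fun t => ∫ s in α..t, θ s) (θ t) t := fun t =>
    intervalIntegral.integral_hasDerivAt_right (hθ.continuous.intervalIntegrable _ _)
      hθ.continuous.stronglyMeasurable.stronglyMeasurableAtFilter hθ.continuous.continuousAt
  have hderiv : deriv (fun t => ∫ s in α..t, θ s) = θ := funext fun t => (hd t).deriv
  have hsupp : Function.support (fun t => ∫ s in α..t, θ s) ⊆ Icc α β := by
    intro t ht
    by_contra hnt
    apply ht
    have hαβ : α ≤ β := hαm hβ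
    rcases lt_or_ge t α with h | h
    · change ∫ s in α..t, θ s = 0
      rw [intervalIntegral.integral_of_ge h.le, integral_Ioc_eq_integral_Ioo,
        setIntegral_eq_zero_of_forall_eq_zero, neg_zero]
      exact fun s hs => hz s fun h' => absurd h'.1 (not_le.2 hs.2)
    · have htβ : β < t := by
        by_contra h'
        exact hnt ⟨h, not_lt.1 h'⟩
      change ∫ s in α..t, θ s = 0
      rw [intervalIntegral.integral_of_le h, ← integral_Icc_eq_integral_Ioc,
        setIntegral_eq_integral_of_forall_compl_eq_zero, h0]
      exact fun s hs => hz s fun h' => hs ⟨h'.1, h'.2.trans htβ.le⟩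
  have hts : tsupport (fun t => ∫ s in α..t, θ s) ⊆ Icc α β :=
    closure_minimal hsupp isClosed_Icc
  refine ⟨fun t => ∫ s in α..t, θ s, ?_, HasCompactSupport.of_support_subset_isCompact
    isCompact_Icc hsupp, hts.trans fun t ht => ⟨(hs hα).1.trans_le ht.1, ht.2.trans_lt (hs hβ).2⟩,
    hderiv⟩
  rw [contDiff_infty_iff_deriv, hderiv]
  exact ⟨fun t => (hd t).differentiableAt, hθ⟩

/-- The lemma of du Bois-Reymond: a function with vanishing weak derivative is constant. -/
theorem ae_eq_const_of_integral_deriv_smul_eq_zero [CompleteSpace X] {a b : ℝ} (hab : a < b)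
    {y : ℝ → X} (hy : IntegrableOn y (Ioo a b))
    (h : ∀ φ : ℝ → ℝ, ContDiff ℝ ((⊤ : ℕ∞) : WithTop ℕ∞) φ → HasCompactSupport φ →
      tsupport φ ⊆ Ioo a b → ∫ t in Ioo a b, deriv φ t • y t = 0) :
    ∃ c : X, ∀ᵐ t ∂(volume.restrict (Ioo a b)), y t = c := by
  obtain ⟨φ₀, hφ₀, hφ₀c, hφ₀s, hφ₀i⟩ : ∃ φ₀ : ℝ → ℝ,
      ContDiff ℝ ((⊤ : ℕ∞) : WithTop ℕ∞) φ₀ ∧ HasCompactSupport φ₀ ∧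
      tsupport φ₀ ⊆ Ioo a b ∧ ∫ t, φ₀ t = 1 := by
    let B : ContDiffBump ((a + b) / 2) :=
      ⟨(b - a) / 8, (b - a) / 4, by linarith, by linarith⟩
    refine ⟨B.normed volume, B.contDiff_normed, B.hasCompactSupport_normed, ?_, B.integral_normed⟩
    rw [B.tsupport_normed_eq, Real.closedBall_eq_Icc]
    change Icc ((a + b) / 2 - (b - a) / 4) ((a + b) / 2 + (b - a) / 4) ⊆ _
    exact fun t ht => ⟨by linarith [ht.1], by linarith [ht.2]⟩
  have hsm : ∀ ψ : ℝ → ℝ, Continuous ψ → HasCompactSupport ψ →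
      IntegrableOn (fun t => ψ t • y t) (Ioo a b) := by
    intro ψ hψ hψc
    obtain ⟨C, hC⟩ := hψ.bounded_above_of_compact_support hψc
    exact hy.bdd_smul C hψ.aestronglyMeasurable (ae_of_all _ hC)
  refine ⟨∫ t in Ioo a b, φ₀ t • y t, ?_⟩
  set c := ∫ t in Ioo a b, φ₀ t • y t with hc
  have key := isOpen_Ioo.ae_eq_zero_of_integral_contDiff_smul_eq_zero (μ := volume)
    (U := Ioo a b) (f := fun t => (Ioo a b).indicator (fun t => y t - c) t) ?_ ?_
  · rw [ae_restrict_iff' measurableSet_Ioo]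
    filter_upwards [key] with t ht hmem
    have := ht hmem
    rw [indicator_of_mem hmem] at this
    exact sub_eq_zero.1 this
  · refine IntegrableOn.locallyIntegrableOn ?_
    have : IntegrableOn (fun t => y t - c) (Ioo a b) :=
      hy.sub (integrableOn_const (by simp))
    exact this.congr_fun (fun t ht => by simp only [indicator_of_mem ht])
      measurableSet_Ioo
  · intro ψ hψ hψc hψs
    have hψ' : Continuous ψ := hψ.continuous
    have e1 : ∫ t, ψ t • (Ioo a b).indicator (fun t => y t - c) t
        = ∫ t in Ioo a b, (ψ t • y t - ψ t • c) := by
      rw [← integral_indicator measurableSet_Ioo]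
      congr 1
      ext t
      by_cases ht : t ∈ Ioo a b <;> simp [ht, smul_sub]
    have hψint : ∫ t in Ioo a b, ψ t = ∫ t, ψ t :=
      setIntegral_eq_integral_of_forall_compl_eq_zero fun t ht =>
        image_eq_zero_of_notMem_tsupport fun h' => ht (hψs h')
    have hψI : Integrable ψ := hψ'.integrable_of_hasCompactSupport hψc
    have hφI : Integrable φ₀ := hφ₀.continuous.integrable_of_hasCompactSupport hφ₀c
    -- Removing the multiple (∫ψ)φ₀ makes the integral zero, so the difference is the derivative of
    -- a test function; testing with it gives ∫ψy = (∫ψ)c.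
    obtain ⟨φ, h1, h2, h3, h4⟩ := exists_smooth_primitive (a := a) (b := b)
      (θ := fun t => ψ t - (∫ t, ψ t) * φ₀ t) (hψ.sub (contDiff_const.mul hφ₀))
      (hψc.sub hφ₀c.mul_left)
      ((tsupport_sub ψ (fun t => (∫ t, ψ t) * φ₀ t)).trans
        (union_subset hψs ((closure_mono (Function.support_mul_subset_right _ _)).trans hφ₀s)))
      (by rw [integral_sub hψI (hφI.const_mul _), integral_const_mul, hφ₀i]; simp)
    have h5 := h φ h1 h2 h3
    rw [h4] at h5
    simp only [sub_smul, mul_smul] at h5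
    have h6 : IntegrableOn (fun t => (∫ t, ψ t) • φ₀ t • y t) (Ioo a b) :=
      (hsm _ hφ₀.continuous hφ₀c).smul (∫ t, ψ t)
    rw [integral_sub (hsm _ hψ' hψc) h6, integral_smul, ← hc] at h5
    rw [e1, integral_sub (hsm _ hψ' hψc) (hψI.integrableOn.smul_const c), integral_smul_const,
      hψint]
    exact h5

/-- A primitive of an integrable function `w` has the weak derivative `w`. -/
theorem hasWeakDeriv_of_ae_eq_primitive [CompleteSpace X] {a b : ℝ} {u w : ℝ → X}
    (hw : IntegrableOn w (Ioo a b)) (hui : IntegrableOn u (Ioo a b))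
    (hu : ∀ᵐ t ∂(volume.restrict (Ioo a b)), u t = ∫ s in a..t, w s) :
    HasWeakDeriv (Ioo a b) u w := by
  refine ⟨hui.locallyIntegrableOn, hw.locallyIntegrableOn, fun φ hφ _ hφs => ?_⟩
  rw [← neg_integral_deriv_smul_primitive hw (hφ.of_le (by exact_mod_cast le_top))
    (image_eq_zero_of_notMem_tsupport fun h => lt_irrefl _ (hφs h).2)]
  congr 1
  refine integral_congr_ae ?_
  filter_upwards [hu] with t ht
  rw [ht]

/-- The primitive of an integrable function on an interval is continuous. -/
theorem continuousOn_primitive_Icc {a b : ℝ} {w : ℝ → X} (hw : IntegrableOn w (Ioo a b)) :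
    ContinuousOn (fun t => ∫ s in a..t, w s) (Icc a b) := by
  rcases le_or_gt a b with hab | hab
  · rw [← uIcc_of_le hab]
    refine intervalIntegral.continuousOn_primitive_interval ?_
    rw [uIcc_of_le hab, integrableOn_Icc_iff_integrableOn_Ioo]
    exact hw
  · rw [Icc_eq_empty (not_le.2 hab)]
    exact continuousOn_empty _

/-- A function with weak derivative `w` and initial value `0` is the primitive of `w`. -/
theorem ae_eq_primitive_of_hasWeakDeriv [CompleteSpace X] {a b : ℝ} (hab : a < b) {u w : ℝ → X}
    (hw : IntegrableOn w (Ioo a b)) (hui : IntegrableOn u (Ioo a b))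
    (h : HasWeakDeriv (Ioo a b) u w) (h0 : HasInitialValue (Ioo a b) a u 0) :
    ∀ᵐ t ∂(volume.restrict (Ioo a b)), u t = ∫ s in a..t, w s := by
  have hcont := continuousOn_primitive_Icc hw
  have hP : IntegrableOn (fun t => ∫ s in a..t, w s) (Ioo a b) :=
    (hcont.integrableOn_Icc).mono_set Ioo_subset_Icc_self
  have hsm : ∀ ψ : ℝ → ℝ, Continuous ψ → HasCompactSupport ψ → ∀ y : ℝ → X,
      IntegrableOn y (Ioo a b) → IntegrableOn (fun t => ψ t • y t) (Ioo a b) := by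
    intro ψ hψ hψc y hy
    obtain ⟨C, hC⟩ := hψ.bounded_above_of_compact_support hψc
    exact hy.bdd_smul C hψ.aestronglyMeasurable (ae_of_all _ hC)
  obtain ⟨c, hc⟩ := ae_eq_const_of_integral_deriv_smul_eq_zero hab
    (y := fun t => u t - ∫ s in a..t, w s) (hui.sub hP) fun φ hφ hφc hφs => by
      have h1 : ContDiff ℝ 1 φ := hφ.of_le (by exact_mod_cast le_top)
      have hd := h1.continuous_deriv le_rfl
      simp only [smul_sub]
      rw [integral_sub (hsm _ hd hφc.deriv _ hui) (hsm _ hd hφc.deriv _ hP),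
        ← neg_inj, neg_sub', h.integral_eq φ hφ hφc hφs,
        neg_integral_deriv_smul_primitive hw h1
          (image_eq_zero_of_notMem_tsupport fun h => lt_irrefl _ (hφs h).2)]
      simp
  obtain ⟨g, hg, hgu, hg0⟩ := h0
  rw [closure_Ioo hab.ne] at hg
  -- Continuity up to the endpoints turns the a.e. identity into an identity on [a, b]; evaluated at
  -- a, it shows that the constant is 0.
  have hD : ContinuousOn (fun t => g t - ∫ s in a..t, w s) (Icc a b) := hg.sub hcont
  have hae : (fun t => g t - ∫ s in a..t, w s) =ᵐ[volume.restrict (Icc a b)] fun _ => c := by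
    rw [← restrict_Ioo_eq_restrict_Icc]
    filter_upwards [hc, hgu] with t h1 h2
    rw [h2, h1]
  have hEq := Measure.eqOn_Icc_of_ae_eq volume hab.ne hae hD continuousOn_const
  have hc0 : c = 0 := by
    have := hEq (left_mem_Icc.2 hab.le)
    simpa [hg0] using this.symm
  filter_upwards [hc] with t ht
  rw [hc0] at ht
  exact sub_eq_zero.1 ht

end WeakDerivative

/-! ### Strongly measurable operator functions acting on L^q -/

section OperatorFunctions

variable {𝕜 D X : Type*} [RCLike 𝕜]
  [NormedAddCommGroup D] [NormedSpace 𝕜 D] [NormedAddCommGroup X] [NormedSpace 𝕜 X]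

/-- A strongly measurable operator function, applied to a measurable function. -/
theorem aestronglyMeasurable_clm_apply {μ : Measure ℝ} {A : ℝ → D →L[𝕜] X} {v : ℝ → D}
    (hA : ∀ x, AEStronglyMeasurable (fun t => A t x) μ) (hv : AEStronglyMeasurable v μ) :
    AEStronglyMeasurable (fun t => A t (v t)) μ := by
  obtain ⟨v', hv', hvv'⟩ := hv
  refine AEStronglyMeasurable.congr (f := fun t => A t (v' t)) ?_
    (hvv'.mono fun t ht => congrArg (A t) ht.symm)
  refine aestronglyMeasurable_of_tendsto_ae atTop (f := fun n t => A t (hv'.approx n t)) ?_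
    (ae_of_all _ fun t => ((A t).continuous.tendsto _).comp (hv'.tendsto_approx t))
  intro n
  -- For a simple function the composition is a finite sum of functions A(t)x cut off to measurable
  -- sets, so strong measurability suffices.
  have : (fun t => A t (hv'.approx n t)) = fun t => ∑ x ∈ (hv'.approx n).range,
      (hv'.approx n ⁻¹' {x}).indicator (fun t => A t x) t := by
    ext t
    rw [Finset.sum_eq_single (hv'.approx n t)]
    · simp
    · intro x _ hx
      exact indicator_of_notMem (fun h => hx (by simpa using h.symm)) _
    · exact fun h => absurd (SimpleFunc.mem_range_self _ t) h
  rw [this]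
  exact Finset.aestronglyMeasurable_fun_sum _ fun x _ =>
    (hA x).indicator (SimpleFunc.measurableSet_preimage _ _)

theorem eLpNorm_clm_apply_le {μ : Measure ℝ} {q : ℝ≥0∞} {A : ℝ → D →L[𝕜] X} {M : ℝ≥0}
    (hM : ∀ᵐ t ∂μ, ‖A t‖ ≤ M) (v : ℝ → D) :
    eLpNorm (fun t => A t (v t)) q μ ≤ M * eLpNorm v q μ := by
  refine (eLpNorm_le_nnreal_smul_eLpNorm_of_ae_le_mul (g := v) (c := M) ?_ q).trans_eq
    (by simp [ENNReal.smul_def])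
  filter_upwards [hM] with t ht
  exact (A t).le_of_opNorm_le ht (v t)

theorem memLp_clm_apply {μ : Measure ℝ} {q : ℝ≥0∞} {A : ℝ → D →L[𝕜] X} {M : ℝ≥0}
    (hA : ∀ x, AEStronglyMeasurable (fun t => A t x) μ)
    (hM : ∀ᵐ t ∂μ, ‖A t‖ ≤ M) {v : ℝ → D} (hv : MemLp v q μ) :
    MemLp (fun t => A t (v t)) q μ :=
  ⟨aestronglyMeasurable_clm_apply hA hv.1,
    (eLpNorm_clm_apply_le hM v).trans_lt (ENNReal.mul_lt_top ENNReal.coe_lt_top hv.2)⟩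

theorem eLpNorm_smul_const (μ : Measure ℝ) (q : ℝ≥0∞) (g : ℝ → 𝕜) (x : D) :
    eLpNorm (fun t => g t • x) q μ = ‖x‖ₑ * eLpNorm g q μ := by
  have h := eLpNorm_const_smul ‖x‖ (fun t => ‖g t‖) q μ
  rw [eLpNorm_norm] at h
  rw [← eLpNorm_norm]
  simpa [Pi.smul_def, norm_smul, mul_comm, enorm_eq_nnnorm] using h

theorem memLp_smul_const {μ : Measure ℝ} {q : ℝ≥0∞} {g : ℝ → 𝕜} (x : D) (hg : MemLp g q μ) :
    MemLp (fun t => g t • x) q μ :=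
  ⟨hg.1.smul_const x, by
    rw [eLpNorm_smul_const]; exact ENNReal.mul_lt_top enorm_lt_top hg.2⟩

end OperatorFunctions

/-! ### Primitives in L^q and splitting of intervals -/

section LpEstimates

/-- The primitive of a function on a short interval is small in `L^q`. -/
theorem eLpNorm_primitive_le {X : Type*} [NormedAddCommGroup X] [NormedSpace ℝ X] {c d : ℝ} {q : ℝ≥0∞} (hq : 1 ≤ q) {w : ℝ → X}
    (hw : MemLp w q (volume.restrict (Ioo c d))) :
    eLpNorm (fun t => ∫ s in c..t, w s) q (volume.restrict (Ioo c d)) ≤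
      ENNReal.ofReal (d - c) * eLpNorm w q (volume.restrict (Ioo c d)) := by
  set μ := volume.restrict (Ioo c d) with hμ
  rcases le_or_gt d c with hdc | hcd
  · have : μ = 0 := by rw [hμ, Ioo_eq_empty (not_lt.2 hdc), Measure.restrict_empty]
    simp [this]
  have hwi : Integrable w μ := hw.integrable hq
  have huniv : μ univ = ENNReal.ofReal (d - c) := by simp [hμ]
  have h1 : ∀ᵐ t ∂μ, ‖∫ s in c..t, w s‖ ≤ ∫ s, ‖w s‖ ∂μ := by
    rw [hμ, ae_restrict_iff' measurableSet_Ioo]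
    refine ae_of_all _ fun t ht => ?_
    rw [intervalIntegral.integral_of_le ht.1.le]
    exact (norm_integral_le_integral_norm _).trans (setIntegral_mono_set hwi.norm
      (ae_of_all _ fun _ => norm_nonneg _)
      (LE.le.eventuallyLE (fun s hs => ⟨hs.1, hs.2.trans_lt ht.2⟩ : Ioc c t ≤ Ioo c d)))
  have hpos : ENNReal.ofReal (d - c) ≠ 0 := by simpa using hcd
  -- The sup bound costs |I|^{1/q} and Hölder from L^1 to L^q costs |I|^{1-1/q}; together this is
  -- the length of the interval.
  refine (eLpNorm_le_of_ae_bound h1).trans ?_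
  rw [ofReal_integral_norm_eq_lintegral_enorm hwi, ← eLpNorm_one_eq_lintegral_enorm]
  refine (mul_le_mul_right (eLpNorm_le_eLpNorm_mul_rpow_measure_univ hq hw.1) _).trans ?_
  rw [huniv, mul_comm (eLpNorm w q μ), ← mul_assoc, ← ENNReal.rpow_add _ _ hpos
    ENNReal.ofReal_ne_top]
  simp

theorem restrict_Ioo_restrict_Iic {a c d : ℝ} (hcd : c ≤ d) :
    (volume.restrict (Ioo a d)).restrict (Iic c) = volume.restrict (Ioo a c) := by
  rw [Measure.restrict_restrict measurableSet_Iic]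
  rcases hcd.eq_or_lt with rfl | hcd
  · rw [inter_eq_right.2 fun t ht => ht.2.le]
  · rw [restrict_Ioo_eq_restrict_Ioc]
    congr 1
    ext t
    simp only [mem_inter_iff, mem_Iic, mem_Ioo, mem_Ioc]
    exact ⟨fun h => ⟨h.2.1, h.1⟩, fun h => ⟨h.2, h.1, h.2.trans_lt hcd⟩⟩

theorem restrict_Ioo_restrict_Ioi {a c d : ℝ} (hac : a ≤ c) :
    (volume.restrict (Ioo a d)).restrict (Ioi c) = volume.restrict (Ioo c d) := by
  rw [Measure.restrict_restrict measurableSet_Ioi]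
  congr 1
  ext t
  simp only [mem_inter_iff, mem_Ioi, mem_Ioo]
  exact ⟨fun h => ⟨h.1, h.2.2⟩, fun h => ⟨h.1, hac.trans_lt h.1, h.2⟩⟩

theorem ae_restrict_Ioo_of_split {a c d : ℝ} (hac : a ≤ c) (hcd : c ≤ d) {P : ℝ → Prop}
    (h1 : ∀ᵐ t ∂(volume.restrict (Ioo a c)), P t) (h2 : ∀ᵐ t ∂(volume.restrict (Ioo c d)), P t) :
    ∀ᵐ t ∂(volume.restrict (Ioo a d)), P t := by
  rw [← restrict_Ioo_restrict_Iic hcd] at h1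
  rw [← restrict_Ioo_restrict_Ioi hac] at h2
  filter_upwards [(ae_restrict_iff' measurableSet_Iic).1 h1,
    (ae_restrict_iff' measurableSet_Ioi).1 h2] with t ht1 ht2
  exact (le_or_gt t c).elim ht1 ht2

theorem eLpNorm_restrict_Ioo_le_add {E : Type*} [NormedAddCommGroup E] {a c d : ℝ} {q : ℝ≥0∞}
    (hq : 1 ≤ q) (hac : a ≤ c) (hcd : c ≤ d) {v : ℝ → E}
    (hv : AEStronglyMeasurable v (volume.restrict (Ioo a d))) :
    eLpNorm v q (volume.restrict (Ioo a d)) ≤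
      eLpNorm v q (volume.restrict (Ioo a c)) + eLpNorm v q (volume.restrict (Ioo c d)) := by
  rw [← restrict_Ioo_restrict_Iic (a := a) hcd, ← restrict_Ioo_restrict_Ioi (d := d) hac,
    ← eLpNorm_indicator_eq_eLpNorm_restrict measurableSet_Iic,
    ← eLpNorm_indicator_eq_eLpNorm_restrict measurableSet_Ioi, ← compl_Iic]
  conv_lhs => rw [← indicator_self_add_compl (Iic c) v]
  exact eLpNorm_add_le (hv.indicator measurableSet_Iic) (hv.indicator measurableSet_Iic.compl) hq

theorem intervalIntegrable_of_memLp {E : Type*} [NormedAddCommGroup E] {a d : ℝ} {q : ℝ≥0∞}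
    (hq : 1 ≤ q) {w : ℝ → E} (hw : MemLp w q (volume.restrict (Ioo a d))) {s t : ℝ}
    (hs : s ∈ Icc a d) (ht : t ∈ Icc a d) : IntervalIntegrable w volume s t := by
  have h' : IntegrableOn w (Ioo a d) volume := hw.integrable hq
  rw [← integrableOn_Icc_iff_integrableOn_Ioo] at h'
  exact (h'.mono_set (uIcc_subset_Icc hs ht)).intervalIntegrable

end LpEstimates

/-! ### Solutions in integrated form: linearity, translation, restriction, extension by zero -/

section MildSolutions

variable {𝕜 D X : Type*} [RCLike 𝕜]
  [NormedAddCommGroup D] [NormedSpace 𝕜 D]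
  [NormedAddCommGroup X] [NormedSpace ℝ X] [NormedSpace 𝕜 X]

/-- `v` solves `v' + A v = f` on `(c, d)` with `v(c) = 0` and `v' = w`, in integrated form. -/
structure MildSolution (c d : ℝ) (q : ℝ≥0∞) (ι : D →L[𝕜] X) (A : ℝ → D →L[𝕜] X)
    (f : ℝ → X) (v : ℝ → D) (w : ℝ → X) : Prop where
  memLp : MemLp v q (volume.restrict (Ioo c d))
  memLp_deriv : MemLp w q (volume.restrict (Ioo c d))
  primitive : ∀ᵐ t ∂(volume.restrict (Ioo c d)), ι (v t) = ∫ s in c..t, w s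
  eqn : ∀ᵐ t ∂(volume.restrict (Ioo c d)), w t + A t (v t) = f t

/-- Existence of mild solutions on `(c, d)` for all right-hand sides in `L^q`, and an a priori
estimate with the constant `K` in `L^q(c, d; D)`. -/
structure MildSolvable (c d : ℝ) (q : ℝ≥0∞) (ι : D →L[𝕜] X) (A : ℝ → D →L[𝕜] X) (K : ℝ≥0) :
    Prop where
  exists_solution : ∀ f : ℝ → X, MemLp f q (volume.restrict (Ioo c d)) →
    ∃ v w, MildSolution c d q ι A f v w
  bound : ∀ f v w, MemLp f q (volume.restrict (Ioo c d)) → MildSolution c d q ι A f v w →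
    eLpNorm v q (volume.restrict (Ioo c d)) ≤ K * eLpNorm f q (volume.restrict (Ioo c d))

namespace MildSolution

variable {c d : ℝ} {q : ℝ≥0∞} {ι : D →L[𝕜] X} {A B : ℝ → D →L[𝕜] X}
  {f f₁ f₂ : ℝ → X} {v v₁ v₂ : ℝ → D} {w w₁ w₂ : ℝ → X}

theorem sub (hq : 1 ≤ q) (h₁ : MildSolution c d q ι A f₁ v₁ w₁)
    (h₂ : MildSolution c d q ι A f₂ v₂ w₂) :
    MildSolution c d q ι A (f₁ - f₂) (v₁ - v₂) (w₁ - w₂) where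
  memLp := h₁.memLp.sub h₂.memLp
  memLp_deriv := h₁.memLp_deriv.sub h₂.memLp_deriv
  primitive := by
    have hI : ∀ {w : ℝ → X}, MemLp w q (volume.restrict (Ioo c d)) → ∀ t ∈ Ioo c d,
        IntervalIntegrable w volume c t := fun hw t ht =>
      intervalIntegrable_of_memLp hq hw ⟨le_rfl, (ht.1.trans ht.2).le⟩ ⟨ht.1.le, ht.2.le⟩
    filter_upwards [h₁.primitive, h₂.primitive, ae_restrict_mem measurableSet_Ioo] with t e1 e2 ht
    simp only [Pi.sub_apply, map_sub]
    rw [e1, e2, intervalIntegral.integral_sub (hI h₁.memLp_deriv t ht) (hI h₂.memLp_deriv t ht)]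
  eqn := by
    filter_upwards [h₁.eqn, h₂.eqn] with t e1 e2
    simp only [Pi.sub_apply, map_sub]
    rw [← e1, ← e2]
    abel

/-- A solution for the operator `A` solves a problem for any other operator `B`. -/
theorem change_operator (h : MildSolution c d q ι A f v w) (B : ℝ → D →L[𝕜] X) :
    MildSolution c d q ι B (fun t => f t + (B t (v t) - A t (v t))) v w where
  memLp := h.memLp
  memLp_deriv := h.memLp_deriv
  primitive := h.primitive
  eqn := by
    filter_upwards [h.eqn] with t e
    rw [← e]
    abel

theorem congr_rhs (h : MildSolution c d q ι A f v w)
    (hf : ∀ᵐ t ∂(volume.restrict (Ioo c d)), f t = f₁ t) : MildSolution c d q ι A f₁ v w where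
  memLp := h.memLp
  memLp_deriv := h.memLp_deriv
  primitive := h.primitive
  eqn := by
    filter_upwards [h.eqn, hf] with t e e'
    rw [e, e']

/-- Read off from w = f - Av. This is why `MildSolvable` need only control v in L^q(D). -/
theorem eLpNorm_deriv_le (hq : 1 ≤ q) {M : ℝ≥0}
    (hA : ∀ x, AEStronglyMeasurable (fun t => A t x) (volume.restrict (Ioo c d)))
    (hM : ∀ᵐ t ∂(volume.restrict (Ioo c d)), ‖A t‖ ≤ M)
    (hf : MemLp f q (volume.restrict (Ioo c d))) (h : MildSolution c d q ι A f v w) :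
    eLpNorm w q (volume.restrict (Ioo c d)) ≤ eLpNorm f q (volume.restrict (Ioo c d)) +
      M * eLpNorm v q (volume.restrict (Ioo c d)) := by
  have e : w =ᵐ[volume.restrict (Ioo c d)] f - fun t => A t (v t) := by
    filter_upwards [h.eqn] with t ht
    simp [← ht]
  rw [eLpNorm_congr_ae e]
  exact (eLpNorm_sub_le hf.1 (aestronglyMeasurable_clm_apply hA h.memLp.1) hq).trans
    (by gcongr; exact eLpNorm_clm_apply_le hM v)

/-- The zero initial value yields the factor d - c, which later makes the term η‖x‖_X of relative
continuity small on short intervals. -/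
theorem eLpNorm_inclusion_le (hq : 1 ≤ q) (h : MildSolution c d q ι A f v w) :
    eLpNorm (fun t => ι (v t)) q (volume.restrict (Ioo c d)) ≤
      ENNReal.ofReal (d - c) * eLpNorm w q (volume.restrict (Ioo c d)) := by
  rw [eLpNorm_congr_ae h.primitive]
  exact eLpNorm_primitive_le hq h.memLp_deriv

/-- Translation of solutions of an autonomous problem. -/
theorem translate {A₀ : D →L[𝕜] X} (h : MildSolution c d q ι (fun _ => A₀) f v w) {c' d' r : ℝ}
    (hc : c' = c + r) (hd : d' = d + r) :
    MildSolution c' d' q ι (fun _ => A₀) (fun t => f (t - r)) (fun t => v (t - r))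
      (fun t => w (t - r)) := by
  subst hc hd
  have hmp : MeasurePreserving (fun t : ℝ => t - r) (volume.restrict (Ioo (c + r) (d + r)))
      (volume.restrict (Ioo c d)) := by
    have := (measurePreserving_sub_right volume r).restrict_preimage
      (measurableSet_Ioo (a := c) (b := d))
    rwa [preimage_sub_const_Ioo] at this
  refine ⟨h.memLp.comp_measurePreserving hmp, h.memLp_deriv.comp_measurePreserving hmp, ?_,
    hmp.quasiMeasurePreserving.ae h.eqn⟩
  filter_upwards [hmp.quasiMeasurePreserving.ae h.primitive] with t ht
  rw [ht, intervalIntegral.integral_comp_sub_right]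
  simp

theorem restrict_left (h : MildSolution c d q ι A f v w) {d' : ℝ} (hd : d' ≤ d) :
    MildSolution c d' q ι A f v w := by
  have hle : volume.restrict (Ioo c d') ≤ volume.restrict (Ioo c d) :=
    Measure.restrict_mono (Ioo_subset_Ioo_right hd) le_rfl
  exact ⟨h.memLp.mono_measure hle, h.memLp_deriv.mono_measure hle, ae_mono hle h.primitive,
    ae_mono hle h.eqn⟩

/-- Extension of a solution by zero to the left. -/
theorem extend_left (h : MildSolution c d q ι A f v w) {a : ℝ} (hac : a ≤ c) (hcd : c ≤ d) :
    MildSolution a d q ι A ((Ioi c).indicator f) ((Ioi c).indicator v)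
      ((Ioi c).indicator w) := by
  refine ⟨?_, ?_, ?_, ?_⟩
  · rw [memLp_indicator_iff_restrict measurableSet_Ioi, restrict_Ioo_restrict_Ioi hac]
    exact h.memLp
  · rw [memLp_indicator_iff_restrict measurableSet_Ioi, restrict_Ioo_restrict_Ioi hac]
    exact h.memLp_deriv
  · refine ae_restrict_Ioo_of_split hac hcd ?_ ?_
    · filter_upwards [ae_restrict_mem measurableSet_Ioo] with t ht
      rw [indicator_of_notMem (by simpa using ht.2.le), map_zero,
        intervalIntegral.integral_zero_ae]
      refine ae_of_all _ fun s hs => indicator_of_notMem ?_ _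
      rw [uIoc_of_le ht.1.le] at hs
      simpa using hs.2.trans ht.2.le
    · filter_upwards [h.primitive, ae_restrict_mem measurableSet_Ioo] with t e ht
      rw [indicator_of_mem (show t ∈ Ioi c from ht.1), e,
        intervalIntegral.integral_of_le (hac.trans ht.1.le),
        intervalIntegral.integral_of_le ht.1.le, setIntegral_indicator measurableSet_Ioi]
      congr 2
      ext s
      simp only [mem_inter_iff, mem_Ioc, mem_Ioi]
      exact ⟨fun h => ⟨⟨hac.trans_lt h.1, h.2⟩, h.1⟩, fun h => ⟨h.2, h.1.2⟩⟩
  · refine ae_restrict_Ioo_of_split hac hcd ?_ ?_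
    · filter_upwards [ae_restrict_mem measurableSet_Ioo] with t ht
      have : t ∉ Ioi c := by simpa using ht.2.le
      simp [indicator_of_notMem this]
    · filter_upwards [h.eqn, ae_restrict_mem measurableSet_Ioo] with t e ht
      have : t ∈ Ioi c := ht.1
      simp [indicator_of_mem this, e]

end MildSolution

namespace MildSolvable

variable {c d : ℝ} {q : ℝ≥0∞} {ι : D →L[𝕜] X} {A : ℝ → D →L[𝕜] X} {K : ℝ≥0}

theorem mono (h : MildSolvable c d q ι A K) {K' : ℝ≥0} (hK : K ≤ K') :
    MildSolvable c d q ι A K' :=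
  ⟨h.exists_solution, fun f v w hf hv => (h.bound f v w hf hv).trans (by gcongr)⟩

/-- Solvability of an autonomous problem is inherited by subintervals. -/
theorem subinterval {A₀ : D →L[𝕜] X} {a b : ℝ} (h : MildSolvable a b q ι (fun _ => A₀) K)
    (hac : a ≤ c) (hcd : c ≤ d) (hdb : d ≤ b) : MildSolvable c d q ι (fun _ => A₀) K := by
  have hmp : ∀ r : ℝ, MeasurePreserving (fun t : ℝ => t - r)
      (volume.restrict (Ioo (c + r) (d + r))) (volume.restrict (Ioo c d)) := fun r => by
    have := (measurePreserving_sub_right volume r).restrict_preimage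
      (measurableSet_Ioo (a := c) (b := d))
    rwa [preimage_sub_const_Ioo] at this
  constructor
  · intro f hf
    -- Existence: shift the data so that they start at a, extend them by zero to the right, solve on
    -- (a, b), restrict and shift back.
    have hf' := hf.comp_measurePreserving (hmp (a - c))
    rw [show c + (a - c) = a by ring,
      ← restrict_Ioo_restrict_Iic (show d + (a - c) ≤ b by linarith),
      ← memLp_indicator_iff_restrict measurableSet_Iic] at hf'
    obtain ⟨v, w, hv⟩ := h.exists_solution _ hf'
    have h1 := (hv.restrict_left (show d + (a - c) ≤ b by linarith)).translate (c' := c)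
      (d' := d) (r := c - a) (by ring) (by ring)
    refine ⟨_, _, h1.congr_rhs ?_⟩
    filter_upwards [ae_restrict_mem measurableSet_Ioo] with t ht
    rw [indicator_of_mem (show t - (c - a) ∈ Iic (d + (a - c)) by
      simp only [mem_Iic]; linarith [ht.2])]
    simp only [Function.comp_apply]
    congr 1
    ring
  · intro f v w hf hv
    -- Bound: here the solution itself has to be extended. Shifted so that it ends at b, it extends
    -- by zero to the left, because its initial value is 0. The constant K is thus unchanged.
    have h1 := (hv.translate (r := b - d) rfl rfl).extend_left (a := a) (by linarith)
      (by linarith)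
    rw [show d + (b - d) = b by ring] at h1
    have hmp' := hmp (b - d)
    rw [show d + (b - d) = b by ring] at hmp'
    have hle : a ≤ c + (b - d) := by linarith
    have hmem : MemLp ((Ioi (c + (b - d))).indicator fun t => f (t - (b - d))) q
        (volume.restrict (Ioo a b)) := by
      rw [memLp_indicator_iff_restrict measurableSet_Ioi, restrict_Ioo_restrict_Ioi hle]
      exact hf.comp_measurePreserving hmp'
    have h2 := h.bound _ _ _ hmem h1
    rw [eLpNorm_indicator_eq_eLpNorm_restrict measurableSet_Ioi,
      eLpNorm_indicator_eq_eLpNorm_restrict measurableSet_Ioi, restrict_Ioo_restrict_Ioi hle] at h2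
    have e1 := eLpNorm_comp_measurePreserving (p := q) hv.memLp.1 hmp'
    have e2 := eLpNorm_comp_measurePreserving (p := q) hf.1 hmp'
    simp only [Function.comp_def] at e1 e2
    rwa [e1, e2] at h2

end MildSolvable

end MildSolutions

/-! ### Relatively small perturbations on short intervals -/

section Perturbation

variable {𝕜 D X : Type*} [RCLike 𝕜]
  [NormedAddCommGroup D] [NormedSpace 𝕜 D]
  [NormedAddCommGroup X] [NormedSpace ℝ X] [NormedSpace 𝕜 X]
  {c d : ℝ} {q : ℝ≥0∞} {ι : D →L[𝕜] X} {A B : ℝ → D →L[𝕜] X}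

/-- The difference of two operators along a solution is controlled by half the right-hand side. -/
theorem MildSolution.eLpNorm_perturbation_le (hq : 1 ≤ q) {K M ε η h : ℝ≥0}
    (hA : ∀ x, AEStronglyMeasurable (fun t => A t x) (volume.restrict (Ioo c d)))
    (hM : ∀ t ∈ Ioo c d, ‖A t‖ ≤ M)
    (hAB : ∀ t ∈ Ioo c d, ∀ x, ‖B t x - A t x‖ ≤ ε * ‖x‖ + η * ‖ι x‖)
    (hh : d - c ≤ h) (hsmall : ε * K + η * (h * (1 + M * K)) ≤ 1 / 2)
    (hS : MildSolvable c d q ι A K) {f : ℝ → X} {v : ℝ → D} {w : ℝ → X}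
    (hf : MemLp f q (volume.restrict (Ioo c d))) (hv : MildSolution c d q ι A f v w) :
    eLpNorm (fun t => B t (v t) - A t (v t)) q (volume.restrict (Ioo c d)) ≤
      (1 / 2 : ℝ≥0) * eLpNorm f q (volume.restrict (Ioo c d)) := by
  set μ := volume.restrict (Ioo c d) with hμ
  have hM' : ∀ᵐ t ∂μ, ‖A t‖ ≤ M := (ae_restrict_mem measurableSet_Ioo).mono hM
  have h1 : eLpNorm (fun t => B t (v t) - A t (v t)) q μ ≤
      eLpNorm ((fun t => (ε : ℝ) * ‖v t‖) + fun t => (η : ℝ) * ‖ι (v t)‖) q μ :=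
    eLpNorm_mono_ae_real ((ae_restrict_mem measurableSet_Ioo).mono fun t ht => hAB t ht (v t))
  have hιv : AEStronglyMeasurable (fun t => ι (v t)) μ :=
    ι.continuous.comp_aestronglyMeasurable hv.memLp.1
  have e1 : eLpNorm (fun t => (ε : ℝ) * ‖v t‖) q μ = ε * eLpNorm v q μ := by
    have := eLpNorm_const_smul (ε : ℝ) (fun t => ‖v t‖) q μ
    rw [eLpNorm_norm] at this
    simpa [Pi.smul_def, enorm_eq_nnnorm] using this
  have e2 : eLpNorm (fun t => (η : ℝ) * ‖ι (v t)‖) q μ = η * eLpNorm (fun t => ι (v t)) q μ := by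
    have := eLpNorm_const_smul (η : ℝ) (fun t => ‖ι (v t)‖) q μ
    rw [eLpNorm_norm] at this
    simpa [Pi.smul_def, enorm_eq_nnnorm] using this
  have h2 := hS.bound f v w hf hv
  have h3 : eLpNorm w q μ ≤ (1 + M * K : ℝ≥0) * eLpNorm f q μ := by
    refine (hv.eLpNorm_deriv_le hq hA hM' hf).trans ?_
    push_cast
    rw [add_mul, one_mul, mul_assoc]
    gcongr
  have h4 : eLpNorm (fun t => ι (v t)) q μ ≤ (h * (1 + M * K) : ℝ≥0) * eLpNorm f q μ := by
    refine (hv.eLpNorm_inclusion_le hq).trans ?_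
    rw [ENNReal.coe_mul, mul_assoc]
    gcongr
    rw [← ENNReal.ofReal_coe_nnreal]
    exact ENNReal.ofReal_le_ofReal hh
  calc eLpNorm (fun t => B t (v t) - A t (v t)) q μ
      ≤ ε * eLpNorm v q μ + η * eLpNorm (fun t => ι (v t)) q μ := by
        rw [← e1, ← e2]
        exact h1.trans (eLpNorm_add_le (hv.memLp.1.norm.const_mul _) (hιv.norm.const_mul _) hq)
    _ ≤ ε * (K * eLpNorm f q μ) + η * ((h * (1 + M * K) : ℝ≥0) * eLpNorm f q μ) := by gcongr
    _ = (ε * K + η * (h * (1 + M * K)) : ℝ≥0) * eLpNorm f q μ := by push_cast; ring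
    _ ≤ _ := by gcongr

/-- Perturbation of solvability by an operator that is relatively small, on a short interval. -/
theorem MildSolvable.perturb [CompleteSpace X] (hq : 1 ≤ q) {K M ε η h : ℝ≥0}
    (hA : ∀ x, AEStronglyMeasurable (fun t => A t x) (volume.restrict (Ioo c d)))
    (hB : ∀ x, AEStronglyMeasurable (fun t => B t x) (volume.restrict (Ioo c d)))
    (hM : ∀ t ∈ Ioo c d, ‖A t‖ ≤ M)
    (hAB : ∀ t ∈ Ioo c d, ∀ x, ‖B t x - A t x‖ ≤ ε * ‖x‖ + η * ‖ι x‖)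
    (hh : d - c ≤ h) (hsmall : ε * K + η * (h * (1 + M * K)) ≤ 1 / 2)
    (hS : MildSolvable c d q ι A K) : MildSolvable c d q ι B (2 * K) := by
  set μ := volume.restrict (Ioo c d) with hμ
  have key : ∀ {f v w}, MemLp f q μ → MildSolution c d q ι A f v w →
      eLpNorm (fun t => B t (v t) - A t (v t)) q μ ≤ (1 / 2 : ℝ≥0) * eLpNorm f q μ :=
    fun hf hv => hv.eLpNorm_perturbation_le hq hA hM hAB hh hsmall hS hf
  have hmeas : ∀ {v}, MemLp v q μ →
      AEStronglyMeasurable (fun t => B t (v t) - A t (v t)) μ := fun hv =>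
    (aestronglyMeasurable_clm_apply hB hv.1).sub (aestronglyMeasurable_clm_apply hA hv.1)
  constructor
  · intro f hf
    -- Let v_g solve the problem for A with data g. It solves the problem for B with data f exactly
    -- when g = f - (B - A)v_g, a fixed-point equation in L^q. The choice of v_g need not be linear:
    -- the difference of two solutions solves the problem for the difference of the data, so `key`
    -- gives the contraction factor 1/2.
    have : Fact (1 ≤ q) := ⟨hq⟩
    choose v w hvw using fun g : Lp X q μ => hS.exists_solution g (Lp.memLp g)
    have hmem : ∀ g : Lp X q μ, MemLp (fun t => B t (v g t) - A t (v g t)) q μ := fun g =>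
      ⟨hmeas (hvw g).memLp, (key (Lp.memLp g) (hvw g)).trans_lt
        (ENNReal.mul_lt_top ENNReal.coe_lt_top (Lp.memLp g).2)⟩
    let Φ : Lp X q μ → Lp X q μ := fun g => (hf.sub (hmem g)).toLp
    have hΦ : ContractingWith (1 / 2) Φ := by
      refine ⟨by rw [← NNReal.coe_lt_coe]; norm_num, fun g₁ g₂ => ?_⟩
      rw [Lp.edist_toLp_toLp, Lp.edist_def]
      refine le_trans (le_of_eq ?_) (key ((Lp.memLp g₁).sub (Lp.memLp g₂))
        ((hvw g₁).sub hq (hvw g₂)))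
      rw [← eLpNorm_neg]
      congr 1
      ext t
      simp only [Pi.neg_apply, Pi.sub_apply, map_sub]
      abel
    have hfix := hΦ.fixedPoint_isFixedPt
    set g := ContractingWith.fixedPoint Φ hΦ
    refine ⟨v g, w g, ((hvw g).change_operator B).congr_rhs ?_⟩
    have e : ∀ᵐ t ∂μ, (Φ g : ℝ → X) t = f t - (B t (v g t) - A t (v g t)) :=
      (hf.sub (hmem g)).coeFn_toLp
    rw [hfix.eq] at e
    filter_upwards [e] with t ht
    rw [ht]
    abel
  · intro f v w hf hv
    have hA' := hv.change_operator A
    have hM' : ∀ᵐ t ∂μ, ‖A t‖ ≤ M := (ae_restrict_mem measurableSet_Ioo).mono hM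
    -- This bound on B ensures that g below lies in L^q; only with a finite norm can ½‖g‖ be
    -- absorbed into the left side of ‖g‖ ≤ ‖f‖ + ½‖g‖.
    have hBM : ∀ᵐ t ∂μ, ‖B t‖ ≤ (M + (ε + η * ‖ι‖₊) : ℝ≥0) := by
      filter_upwards [ae_restrict_mem measurableSet_Ioo] with t ht
      refine ContinuousLinearMap.opNorm_le_bound _ (NNReal.coe_nonneg _) fun x => ?_
      have h1 := hAB t ht x
      have h2 := (A t).le_of_opNorm_le (hM t ht) x
      have h3 := norm_le_norm_add_norm_sub (A t x) (B t x)
      have h4 : (η : ℝ) * ‖ι x‖ ≤ η * (‖ι‖ * ‖x‖) := by gcongr; exact ι.le_opNorm x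
      rw [norm_sub_rev] at h3
      push_cast
      linarith
    have hmem : MemLp (fun t => A t (v t) - B t (v t)) q μ :=
      (memLp_clm_apply hA hM' hv.memLp).sub (memLp_clm_apply hB hBM hv.memLp)
    have hgm : MemLp (fun t => f t + (A t (v t) - B t (v t))) q μ := hf.add hmem
    set g := fun t => f t + (A t (v t) - B t (v t)) with hg
    have h1 : eLpNorm (fun t => A t (v t) - B t (v t)) q μ ≤ (1 / 2 : ℝ≥0) * eLpNorm g q μ := by
      refine le_trans (le_of_eq ?_) (key hgm hA')
      rw [← eLpNorm_neg]
      congr 1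
      ext t
      simp
    have h2 : eLpNorm g q μ ≤ eLpNorm f q μ + (1 / 2 : ℝ≥0) * eLpNorm g q μ :=
      (eLpNorm_add_le hf.1 hmem.1 hq).trans (by gcongr)
    have h3 : eLpNorm g q μ ≤ 2 * eLpNorm f q μ := by
      have hgt := hgm.2.ne
      have hft := hf.2.ne
      lift eLpNorm g q μ to ℝ≥0 using hgt with G
      lift eLpNorm f q μ to ℝ≥0 using hft with F
      norm_cast at h2 ⊢
      rw [← NNReal.coe_le_coe] at h2 ⊢
      push_cast at h2 ⊢
      linarith
    refine (hS.bound g v w hgm hA').trans ((mul_le_mul_right h3 _).trans_eq ?_)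
    push_cast
    ring

end Perturbation

/-! ### Joining adjacent intervals by reflection -/

section Gluing

variable {𝕜 D X : Type*} [RCLike 𝕜]
  [NormedAddCommGroup D] [NormedSpace 𝕜 D]
  [NormedAddCommGroup X] [NormedSpace ℝ X] [NormedSpace 𝕜 X]
  {a c d : ℝ} {q : ℝ≥0∞} {ι : D →L[𝕜] X} {A : ℝ → D →L[𝕜] X}

theorem measurePreserving_reflection :
    MeasurePreserving (fun t : ℝ => 2 * c - t) (volume.restrict (Ioo c d))
      (volume.restrict (Ioo (2 * c - d) c)) := by
  have := (Measure.measurePreserving_sub_left volume (2 * c)).restrict_preimage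
    (measurableSet_Ioo (a := 2 * c - d) (b := c))
  rwa [preimage_const_sub_Ioo, show 2 * c - c = c by ring, sub_sub_cancel] at this

theorem eLpNorm_reflection_le {E : Type*} [NormedAddCommGroup E] (hdc : d - c ≤ c - a)
    {v : ℝ → E} (hv : AEStronglyMeasurable v (volume.restrict (Ioo a c))) :
    eLpNorm (fun t => v (2 * c - t)) q (volume.restrict (Ioo c d)) ≤
      eLpNorm v q (volume.restrict (Ioo a c)) := by
  have hle : volume.restrict (Ioo (2 * c - d) c) ≤ volume.restrict (Ioo a c) :=
    Measure.restrict_mono (Ioo_subset_Ioo_left (by linarith)) le_rfl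
  exact (eLpNorm_comp_measurePreserving (hv.mono_measure hle)
    measurePreserving_reflection).trans_le (eLpNorm_mono_measure _ hle)

theorem memLp_reflection {E : Type*} [NormedAddCommGroup E] (hdc : d - c ≤ c - a)
    {v : ℝ → E} (hv : MemLp v q (volume.restrict (Ioo a c))) :
    MemLp (fun t => v (2 * c - t)) q (volume.restrict (Ioo c d)) :=
  (hv.mono_measure (Measure.restrict_mono (Ioo_subset_Ioo_left (by linarith)) le_rfl)
    ).comp_measurePreserving measurePreserving_reflection

/-- The reflection of a solution continues its primitive. -/
theorem MildSolution.primitive_reflection (hq : 1 ≤ q) (hdc : d - c ≤ c - a)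
    {f : ℝ → X} {v : ℝ → D} {w : ℝ → X} (h : MildSolution a c q ι A f v w) :
    ∀ᵐ t ∂(volume.restrict (Ioo c d)),
      ι (v (2 * c - t)) = (∫ s in a..c, w s) + ∫ s in c..t, -w (2 * c - s) := by
  have hle : volume.restrict (Ioo (2 * c - d) c) ≤ volume.restrict (Ioo a c) :=
    Measure.restrict_mono (Ioo_subset_Ioo_left (by linarith)) le_rfl
  filter_upwards [measurePreserving_reflection.quasiMeasurePreserving.ae
    (ae_mono hle h.primitive), ae_restrict_mem measurableSet_Ioo] with t e ht
  have hac : a ≤ c := by linarith [ht.1, ht.2]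
  have hi := intervalIntegrable_of_memLp hq h.memLp_deriv (s := a) (t := 2 * c - t)
    ⟨le_rfl, hac⟩ ⟨by linarith [ht.2], by linarith [ht.1]⟩
  have hi' := intervalIntegrable_of_memLp hq h.memLp_deriv (s := 2 * c - t) (t := c)
    ⟨by linarith [ht.2], by linarith [ht.1]⟩ ⟨hac, le_rfl⟩
  rw [e, intervalIntegral.integral_neg, intervalIntegral.integral_comp_sub_left,
    show 2 * c - c = c by ring, ← intervalIntegral.integral_add_adjacent_intervals hi hi']
  abel

/-- Two solvable intervals can be joined if the second is not longer than the first. -/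
theorem MildSolvable.glue (hq : 1 ≤ q) {K₁ K₂ M : ℝ≥0} (hcd : c ≤ d) (hdc : d - c ≤ c - a)
    (hA : ∀ x, AEStronglyMeasurable (fun t => A t x) (volume.restrict (Ioo a d)))
    (hM : ∀ t ∈ Ioo a d, ‖A t‖ ≤ M)
    (h₁ : MildSolvable a c q ι A K₁) (h₂ : MildSolvable c d q ι A K₂) :
    MildSolvable a d q ι A (2 * K₁ + K₂ * (2 + 2 * M * K₁)) := by
  have hac : a ≤ c := by linarith
  have hleL : volume.restrict (Ioo a c) ≤ volume.restrict (Ioo a d) :=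
    Measure.restrict_mono (Ioo_subset_Ioo_right hcd) le_rfl
  have hleR : volume.restrict (Ioo c d) ≤ volume.restrict (Ioo a d) :=
    Measure.restrict_mono (Ioo_subset_Ioo_left hac) le_rfl
  have hMd : ∀ᵐ t ∂(volume.restrict (Ioo a d)), ‖A t‖ ≤ M :=
    (ae_restrict_mem measurableSet_Ioo).mono hM
  have hAL := fun x => (hA x).mono_measure hleL
  have hAR := fun x => (hA x).mono_measure hleR
  -- The reflection t ↦ v(2c - t) has derivative -w(2c - t). A solution on (c, d) is this reflection
  -- plus a correction starting from 0, and the function here is the right-hand side for the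
  -- correction.
  have hrhs : ∀ {f : ℝ → X} {v : ℝ → D} {w : ℝ → X}, MemLp f q (volume.restrict (Ioo c d)) →
      MemLp v q (volume.restrict (Ioo a c)) → MemLp w q (volume.restrict (Ioo a c)) →
      MemLp (fun t => f t + w (2 * c - t) - A t (v (2 * c - t))) q
        (volume.restrict (Ioo c d)) := fun hf hv hw =>
    (hf.add (memLp_reflection hdc hw)).sub
      (memLp_clm_apply hAR (ae_mono hleR hMd) (memLp_reflection hdc hv))
  constructor
  · intro f hf
    obtain ⟨v₁, w₁, hv₁⟩ := h₁.exists_solution f (hf.mono_measure hleL)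
    obtain ⟨v₂, w₂, hv₂⟩ := h₂.exists_solution _
      (hrhs (hf.mono_measure hleR) hv₁.memLp hv₁.memLp_deriv)
    have hvR : MemLp (fun t => v₁ (2 * c - t) + v₂ t) q (volume.restrict (Ioo c d)) :=
      (memLp_reflection hdc hv₁.memLp).add hv₂.memLp
    have hwR : MemLp (fun t => -w₁ (2 * c - t) + w₂ t) q (volume.restrict (Ioo c d)) :=
      (memLp_reflection hdc hv₁.memLp_deriv).neg.add hv₂.memLp_deriv
    let v : ℝ → D := fun t => (Iic c).indicator v₁ t +
      (Ioi c).indicator (fun t => v₁ (2 * c - t) + v₂ t) t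
    let w : ℝ → X := fun t => (Iic c).indicator w₁ t +
      (Ioi c).indicator (fun t => -w₁ (2 * c - t) + w₂ t) t
    have hvL' : ∀ t ≤ c, v t = v₁ t := fun t ht => by
      simp [v, ht]
    have hwL' : ∀ t ≤ c, w t = w₁ t := fun t ht => by
      simp [w, ht]
    have hvR' : ∀ t, c < t → v t = v₁ (2 * c - t) + v₂ t := fun t ht => by
      simp [v, ht]
    have hwR' : ∀ t, c < t → w t = -w₁ (2 * c - t) + w₂ t := fun t ht => by
      simp [w, ht]
    have hwm : MemLp w q (volume.restrict (Ioo a d)) := by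
      refine MemLp.add ?_ ?_
      · rw [memLp_indicator_iff_restrict measurableSet_Iic, restrict_Ioo_restrict_Iic hcd]
        exact hv₁.memLp_deriv
      · rw [memLp_indicator_iff_restrict measurableSet_Ioi, restrict_Ioo_restrict_Ioi hac]
        exact hwR
    have hprimL : ∀ t ∈ Icc a c, ∫ s in a..t, w s = ∫ s in a..t, w₁ s := fun t ht =>
      intervalIntegral.integral_congr fun s hs => by
        rw [uIcc_of_le ht.1] at hs
        exact hwL' s (hs.2.trans ht.2)
    refine ⟨v, w, ?_, hwm, ?_, ?_⟩
    · refine MemLp.add ?_ ?_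
      · rw [memLp_indicator_iff_restrict measurableSet_Iic, restrict_Ioo_restrict_Iic hcd]
        exact hv₁.memLp
      · rw [memLp_indicator_iff_restrict measurableSet_Ioi, restrict_Ioo_restrict_Ioi hac]
        exact hvR
    · refine ae_restrict_Ioo_of_split hac hcd ?_ ?_
      · filter_upwards [hv₁.primitive, ae_restrict_mem measurableSet_Ioo] with t e ht
        rw [hvL' t ht.2.le, e, hprimL t ⟨ht.1.le, ht.2.le⟩]
      · filter_upwards [hv₁.primitive_reflection hq hdc, hv₂.primitive,
          ae_restrict_mem measurableSet_Ioo] with t e₁ e₂ ht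
        have hcI : c ∈ Icc a d := ⟨hac, hcd⟩
        have htI : t ∈ Icc a d := ⟨hac.trans ht.1.le, ht.2.le⟩
        have hright : ∫ s in c..t, w s = ∫ s in c..t, (-w₁ (2 * c - s) + w₂ s) := by
          refine intervalIntegral.integral_congr_ae (ae_of_all _ fun s hs => ?_)
          rw [uIoc_of_le ht.1.le] at hs
          exact hwR' s hs.1
        rw [hvR' t ht.1, map_add, e₁, e₂, ← intervalIntegral.integral_add_adjacent_intervals
          (intervalIntegrable_of_memLp hq hwm ⟨le_rfl, hac.trans hcd⟩ hcI)
          (intervalIntegrable_of_memLp hq hwm hcI htI), hprimL c ⟨hac, le_rfl⟩, hright,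
          intervalIntegral.integral_add, add_assoc]
        · exact intervalIntegrable_of_memLp hq (memLp_reflection hdc hv₁.memLp_deriv).neg
            ⟨le_rfl, hcd⟩ ⟨ht.1.le, ht.2.le⟩
        · exact intervalIntegrable_of_memLp hq hv₂.memLp_deriv
            ⟨le_rfl, hcd⟩ ⟨ht.1.le, ht.2.le⟩
    · refine ae_restrict_Ioo_of_split hac hcd ?_ ?_
      · filter_upwards [hv₁.eqn, ae_restrict_mem measurableSet_Ioo] with t e ht
        rw [hvL' t ht.2.le, hwL' t ht.2.le, e]
      · filter_upwards [hv₂.eqn, ae_restrict_mem measurableSet_Ioo] with t e ht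
        rw [hvR' t ht.1, hwR' t ht.1, map_add, ← sub_eq_zero]
        rw [← sub_eq_zero] at e
        rw [← e]
        abel
  · intro f v w hf hv
    set F := eLpNorm f q (volume.restrict (Ioo a d)) with hF
    have hfL := hf.mono_measure hleL
    have hfR := hf.mono_measure hleR
    have hFL : eLpNorm f q (volume.restrict (Ioo a c)) ≤ F := eLpNorm_mono_measure _ hleL
    have hFR : eLpNorm f q (volume.restrict (Ioo c d)) ≤ F := eLpNorm_mono_measure _ hleR
    have hvL := hv.restrict_left hcd
    have b1 : eLpNorm v q (volume.restrict (Ioo a c)) ≤ K₁ * F :=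
      (h₁.bound f v w hfL hvL).trans (by gcongr)
    have b2 : eLpNorm w q (volume.restrict (Ioo a c)) ≤ F + M * (K₁ * F) :=
      (hvL.eLpNorm_deriv_le hq hAL (ae_mono hleL hMd) hfL).trans (by gcongr)
    have hrv := memLp_reflection hdc hvL.memLp
    have hrw := memLp_reflection hdc hvL.memLp_deriv
    -- Conversely, subtracting its own reflection from a given solution removes the value at c, so
    -- that the bound on (c, d) applies.
    have hR : MildSolution c d q ι A (fun t => f t + w (2 * c - t) - A t (v (2 * c - t)))
        (fun t => v t - v (2 * c - t)) (fun t => w t - -w (2 * c - t)) := by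
      refine ⟨(hv.memLp.mono_measure hleR).sub hrv, (hv.memLp_deriv.mono_measure hleR).sub
        hrw.neg, ?_, ?_⟩
      · filter_upwards [hvL.primitive_reflection hq hdc, ae_mono hleR hv.primitive,
          ae_restrict_mem measurableSet_Ioo] with t e₁ e₂ ht
        have hcI : c ∈ Icc a d := ⟨hac, hcd⟩
        have htI : t ∈ Icc a d := ⟨hac.trans ht.1.le, ht.2.le⟩
        rw [map_sub, e₁, e₂, intervalIntegral.integral_sub,
          ← intervalIntegral.integral_add_adjacent_intervals
          (intervalIntegrable_of_memLp hq hv.memLp_deriv ⟨le_rfl, hac.trans hcd⟩ hcI)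
          (intervalIntegrable_of_memLp hq hv.memLp_deriv hcI htI)]
        · abel
        · exact intervalIntegrable_of_memLp hq hv.memLp_deriv hcI htI
        · exact intervalIntegrable_of_memLp hq hrw.neg ⟨le_rfl, hcd⟩ ⟨ht.1.le, ht.2.le⟩
      · filter_upwards [ae_mono hleR hv.eqn] with t e
        rw [← e, map_sub]
        abel
    have b3 := h₂.bound _ _ _ (hrhs hfR hvL.memLp hvL.memLp_deriv) hR
    have b4 : eLpNorm (fun t => f t + w (2 * c - t) - A t (v (2 * c - t))) q
        (volume.restrict (Ioo c d)) ≤ F + (F + M * (K₁ * F)) + M * (K₁ * F) := by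
      refine (eLpNorm_sub_le (hfR.add hrw).1 (aestronglyMeasurable_clm_apply hAR hrv.1)
        hq).trans ?_
      gcongr
      · refine (eLpNorm_add_le hfR.1 hrw.1 hq).trans ?_
        gcongr
        exact (eLpNorm_reflection_le hdc hvL.memLp_deriv.1).trans b2
      · refine (eLpNorm_clm_apply_le (ae_mono hleR hMd) _).trans ?_
        gcongr
        exact (eLpNorm_reflection_le hdc hvL.memLp.1).trans b1
    -- The correction contributes K₂(2 + 2MK₁)F and the reflection K₁F; the second K₁F of the final
    -- constant comes from (a, c).
    have b5 : eLpNorm v q (volume.restrict (Ioo c d)) ≤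
        K₂ * (F + (F + M * (K₁ * F)) + M * (K₁ * F)) + K₁ * F := by
      have e : v = (fun t => v t - v (2 * c - t)) + fun t => v (2 * c - t) := by
        ext t; simp
      conv_lhs => rw [e]
      refine (eLpNorm_add_le hR.memLp.1 hrv.1 hq).trans ?_
      gcongr
      · exact b3.trans (by gcongr)
      · exact (eLpNorm_reflection_le hdc hvL.memLp.1).trans b1
    refine (eLpNorm_restrict_Ioo_le_add hq hac hcd hv.memLp.1).trans
      ((add_le_add b1 b5).trans_eq ?_)
    push_cast
    ring

end Gluing

/-! ### Pointwise convergence of operators and dominated convergence -/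

section OperatorConvergence

variable {𝕜 D X Λ : Type*} [RCLike 𝕜]
  [NormedAddCommGroup D] [NormedSpace 𝕜 D] [NormedAddCommGroup X] [NormedSpace 𝕜 X]
  [MetricSpace Λ] {q : ℝ≥0∞} {O : Set Λ} {A : Λ → ℝ → D →L[𝕜] X} {lbar : Λ}

/-- Convergence in `L^q` of operators that are uniformly bounded and converge pointwise. -/
theorem tendsto_eLpNorm_clm_apply_sub {μ : Measure ℝ} (hq0 : q ≠ 0) (hq : q ≠ ⊤) {M : ℝ≥0}
    (hmeas : ∀ l ∈ insert lbar O, ∀ x, AEStronglyMeasurable (fun t => A l t x) μ)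
    (hM : ∀ l ∈ insert lbar O, ∀ᵐ t ∂μ, ‖A l t‖ ≤ M)
    (hconv : ∀ᵐ t ∂μ, Tendsto (fun l => A l t) (𝓝[O] lbar) (𝓝 (A lbar t)))
    {v : ℝ → D} (hv : MemLp v q μ) :
    Tendsto (fun l => eLpNorm (fun t => A l t (v t) - A lbar t (v t)) q μ) (𝓝[O] lbar)
      (𝓝 0) := by
  have hqr : 0 < q.toReal := ENNReal.toReal_pos hq0 hq
  simp only [eLpNorm_eq_lintegral_rpow_enorm_toReal hq0 hq]
  have hlbarmem : lbar ∈ insert lbar O := mem_insert _ _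
  have key : Tendsto (fun l => ∫⁻ t, ‖A l t (v t) - A lbar t (v t)‖ₑ ^ q.toReal ∂μ)
      (𝓝[O] lbar) (𝓝 (∫⁻ _, 0 ∂μ)) := by
    -- The majorant is (2M‖v‖)^q. Dominated convergence applies along the filter itself, which is
    -- countably generated as Λ is a metric space.
    refine tendsto_lintegral_filter_of_dominated_convergence'
      (fun t => ((2 * M : ℝ≥0) * ‖v t‖ₑ) ^ q.toReal) ?_ ?_ ?_ ?_
    · filter_upwards [self_mem_nhdsWithin] with l hl
      exact ((aestronglyMeasurable_clm_apply (hmeas l (mem_insert_of_mem _ hl)) hv.1).sub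
        (aestronglyMeasurable_clm_apply (hmeas _ hlbarmem) hv.1)).enorm.pow_const _
    · filter_upwards [self_mem_nhdsWithin] with l hl
      filter_upwards [hM l (mem_insert_of_mem _ hl), hM _ hlbarmem] with t h1 h2
      gcongr
      rw [enorm_eq_nnnorm, enorm_eq_nnnorm]
      norm_cast
      rw [← NNReal.coe_le_coe]
      push_cast
      refine (norm_sub_le _ _).trans ?_
      linarith [(A l t).le_of_opNorm_le h1 (v t), (A lbar t).le_of_opNorm_le h2 (v t)]
    · simp only [ENNReal.mul_rpow_of_nonneg _ _ hqr.le]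
      rw [lintegral_const_mul' _ _ (ENNReal.rpow_ne_top_of_nonneg hqr.le ENNReal.coe_ne_top)]
      exact ENNReal.mul_ne_top (ENNReal.rpow_ne_top_of_nonneg hqr.le ENNReal.coe_ne_top)
        (lintegral_rpow_enorm_lt_top_of_eLpNorm_lt_top hq0 hq hv.2).ne
    · filter_upwards [hconv] with t ht
      have h1 : Tendsto (fun l => A l t (v t) - A lbar t (v t)) (𝓝[O] lbar) (𝓝 0) := by
        have h2 : Tendsto (fun l => A l t (v t)) (𝓝[O] lbar) (𝓝 (A lbar t (v t))) :=
          ((ContinuousLinearMap.apply 𝕜 X (v t)).continuous.tendsto _).comp ht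
        simpa using h2.sub_const (A lbar t (v t))
      have h3 := (ENNReal.continuous_rpow_const (y := q.toReal)).tendsto 0
      rw [ENNReal.zero_rpow_of_pos hqr] at h3
      refine h3.comp ?_
      simpa using h1.enorm
  rw [lintegral_zero] at key
  have h3 := (ENNReal.continuous_rpow_const (y := 1 / q.toReal)).tendsto 0
  rw [ENNReal.zero_rpow_of_pos (by positivity)] at h3
  exact h3.comp key

end OperatorConvergence

/-! ### Between MR^p solutions and mild solutions -/

section Correspondence

variable {𝕜 D X : Type*} [RCLike 𝕜]
  [NormedAddCommGroup D] [NormedSpace 𝕜 D]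
  [NormedAddCommGroup X] [NormedSpace ℝ X] [NormedSpace 𝕜 X]
  {a b p : ℝ} {ι : D →L[𝕜] X} {A : ℝ → D →L[𝕜] X} {f : ℝ → X} {v : ℝ → D} {w : ℝ → X}

theorem MildSolution.memMR [CompleteSpace X] (hp : 1 ≤ p)
    (h : MildSolution a b (ENNReal.ofReal p) ι A f v w) : MemMR (Ioo a b) p ι v w := by
  have hq : 1 ≤ ENNReal.ofReal p := by simpa using hp
  exact ⟨h.memLp, h.memLp_deriv, hasWeakDeriv_of_ae_eq_primitive (h.memLp_deriv.integrable hq)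
    ((ι.comp_memLp' h.memLp).integrable hq) h.primitive⟩

/-- On a bounded interval, solutions with initial value `0` are the same as mild solutions. -/
theorem isSolution_iff_exists_mildSolution [CompleteSpace X] (hp : 1 ≤ p) (hab : a < b) :
    IsSolution (Ioo a b) a p ι A f v ↔
      ∃ w, MildSolution a b (ENNReal.ofReal p) ι A f v w := by
  have hq : 1 ≤ ENNReal.ofReal p := by simpa using hp
  constructor
  · rintro ⟨⟨w, hw, he⟩, h0⟩
    exact ⟨w, hw.memLp, hw.memLp_deriv, ae_eq_primitive_of_hasWeakDeriv hab
      (hw.memLp_deriv.integrable hq) ((ι.comp_memLp' hw.memLp).integrable hq) hw.weakDeriv h0, he⟩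
  · rintro ⟨w, h⟩
    refine ⟨⟨w, h.memMR hp, h.eqn⟩, fun t => ∫ s in a..t, w s, ?_, ?_, by simp⟩
    · rw [closure_Ioo hab.ne]
      exact continuousOn_primitive_Icc (h.memLp_deriv.integrable hq)
    · filter_upwards [h.primitive] with t ht using ht.symm

theorem eLpNorm_le_mrNorm (hp : 1 ≤ p) (I : Set ℝ) (v : ℝ → D) :
    eLpNorm v (ENNReal.ofReal p) (volume.restrict I) ≤ mrNorm I p ι v := by
  refine le_iInf₂ fun w _ => ?_
  have hp0 : 0 < p := by linarith
  rw [one_div, ENNReal.le_rpow_inv_iff hp0]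
  exact le_add_right le_add_self

theorem mrNorm_le_add (hp : 1 ≤ p) (hv : MemMR (Ioo a b) p ι v w) :
    mrNorm (Ioo a b) p ι v ≤
      eLpNorm (fun t => ι (v t)) (ENNReal.ofReal p) (volume.restrict (Ioo a b)) +
      eLpNorm v (ENNReal.ofReal p) (volume.restrict (Ioo a b)) +
      ENNReal.ofReal (b - a) * eLpNorm w (ENNReal.ofReal p) (volume.restrict (Ioo a b)) := by
  have hp0 : 0 < p := by linarith
  -- The ℓ^p norm is at most the ℓ^1 norm for p ≥ 1.
  have hadd : ∀ x y : ℝ≥0∞, x ^ p + y ^ p ≤ (x + y) ^ p := fun x y => by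
    have := ENNReal.rpow_add_rpow_le_add x y hp
    rwa [one_div, ENNReal.rpow_inv_le_iff hp0] at this
  refine (iInf₂_le w hv).trans ?_
  have htw : timeWeight (Ioo a b) = ENNReal.ofReal (b - a) := by simp [timeWeight]
  rw [htw, one_div, ENNReal.rpow_inv_le_iff hp0, ← ENNReal.mul_rpow_of_nonneg _ _ hp0.le]
  exact (add_le_add (hadd _ _) le_rfl).trans (hadd _ _)

/-- The three summands of the constant bound v in L^p(X), v in L^p(D), and the weighted derivative
by way of the equation. The constant involves A only through K and M, so it is uniform in the
parameter. -/
theorem MildSolution.mrNorm_le [CompleteSpace X] (hp : 1 ≤ p) {K M : ℝ≥0}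
    (hA : ∀ x, AEStronglyMeasurable (fun t => A t x) (volume.restrict (Ioo a b)))
    (hM : ∀ t ∈ Ioo a b, ‖A t‖ ≤ M) (hS : MildSolvable a b (ENNReal.ofReal p) ι A K)
    (hf : MemLp f (ENNReal.ofReal p) (volume.restrict (Ioo a b)))
    (h : MildSolution a b (ENNReal.ofReal p) ι A f v w) :
    mrNorm (Ioo a b) p ι v ≤ (‖ι‖₊ * K + K + (b - a).toNNReal * (1 + M * K) : ℝ≥0) *
      eLpNorm f (ENNReal.ofReal p) (volume.restrict (Ioo a b)) := by
  have hq : 1 ≤ ENNReal.ofReal p := by simpa using hp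
  have h1 := hS.bound f v w hf h
  have h2 := h.eLpNorm_deriv_le hq hA ((ae_restrict_mem measurableSet_Ioo).mono hM) hf
  have h3 : eLpNorm (fun t => ι (v t)) (ENNReal.ofReal p) (volume.restrict (Ioo a b)) ≤
      ‖ι‖₊ * eLpNorm v (ENNReal.ofReal p) (volume.restrict (Ioo a b)) :=
    eLpNorm_clm_apply_le (A := fun _ => ι) (M := ‖ι‖₊) (ae_of_all _ fun _ => le_rfl) v
  refine (mrNorm_le_add hp (h.memMR hp)).trans ?_
  set F := eLpNorm f (ENNReal.ofReal p) (volume.restrict (Ioo a b))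
  calc _ ≤ ‖ι‖₊ * (K * F) + K * F + ENNReal.ofReal (b - a) * (F + M * (K * F)) := by
        gcongr
        · exact h3.trans (by gcongr)
        · exact h2.trans (by gcongr)
    _ = _ := by
        rw [ENNReal.ofReal]
        push_cast
        ring

/-- Uniqueness transfers the estimate from the solution provided to an arbitrary one. -/
theorem SolvableWith.mildSolvable [CompleteSpace X] (hp : 1 ≤ p) (hab : a < b) {K : ℝ≥0}
    (h : SolvableWith (Ioo a b) a p ι A K) : MildSolvable a b (ENNReal.ofReal p) ι A K := by
  constructor
  · intro f hf
    obtain ⟨v, hv, -⟩ := h f hf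
    exact ⟨v, (isSolution_iff_exists_mildSolution hp hab).1 hv⟩
  · intro f v w hf hv
    obtain ⟨v₀, -, huniq, hle⟩ := h f hf
    rw [eLpNorm_congr_ae (huniq v ((isSolution_iff_exists_mildSolution hp hab).2 ⟨w, hv⟩))]
    exact (eLpNorm_le_mrNorm hp _ _).trans hle

theorem MildSolvable.solvableWith [CompleteSpace X] (hp : 1 ≤ p) (hab : a < b) {K M : ℝ≥0}
    (hA : ∀ x, AEStronglyMeasurable (fun t => A t x) (volume.restrict (Ioo a b)))
    (hM : ∀ t ∈ Ioo a b, ‖A t‖ ≤ M) (hS : MildSolvable a b (ENNReal.ofReal p) ι A K) :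
    SolvableWith (Ioo a b) a p ι A (‖ι‖₊ * K + K + (b - a).toNNReal * (1 + M * K)) := by
  have hq : 1 ≤ ENNReal.ofReal p := by simpa using hp
  intro f hf
  obtain ⟨v, w, hv⟩ := hS.exists_solution f hf
  refine ⟨v, (isSolution_iff_exists_mildSolution hp hab).2 ⟨w, hv⟩, fun v' hv' => ?_,
    hv.mrNorm_le hp hA hM hS hf⟩
  obtain ⟨w', hw'⟩ := (isSolution_iff_exists_mildSolution hp hab).1 hv'
  have hsub := hw'.sub hq hv
  -- The difference of two solutions has right-hand side f - f = 0, so the a priori bound forces it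
  -- to vanish.
  have h0 := hS.bound _ _ _ (hf.sub hf) hsub
  rw [sub_self, eLpNorm_zero, mul_zero, nonpos_iff_eq_zero,
    eLpNorm_eq_zero_iff hsub.memLp.1 (by positivity)] at h0
  filter_upwards [h0] with t ht
  exact sub_eq_zero.1 ht

/-- Solvability of the autonomous problem on a bounded interval implies that the graph norm is
equivalent to the norm of `D`: test with `t ↦ (t - a) x`. -/
theorem MildSolvable.graphNormEquiv [CompleteSpace X] [IsScalarTower ℝ 𝕜 X] {q : ℝ≥0∞}
    (hq : 1 ≤ q) (hab : a < b) {A₀ : D →L[𝕜] X} {K : ℝ≥0}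
    (hS : MildSolvable a b q ι (fun _ => A₀) K) : GraphNormEquiv ι A₀ := by
  set μ := volume.restrict (Ioo a b) with hμ
  let τ : ℝ → 𝕜 := fun t => ((t - a : ℝ) : 𝕜)
  have hτc : Continuous τ := RCLike.continuous_ofReal.comp (continuous_id.sub continuous_const)
  have hτ : MemLp τ q μ := by
    refine MemLp.of_bound hτc.aestronglyMeasurable (b - a) ?_
    filter_upwards [ae_restrict_mem measurableSet_Ioo] with t ht
    rw [RCLike.norm_ofReal, abs_of_pos (sub_pos.2 ht.1)]
    linarith [ht.2]
  have h1 : MemLp (fun _ : ℝ => (1 : 𝕜)) q μ := memLp_const 1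
  have hα0 : eLpNorm τ q μ ≠ 0 := by
    intro h0
    rw [eLpNorm_eq_zero_iff hτc.aestronglyMeasurable (by positivity)] at h0
    have : ∀ᵐ t ∂μ, False := by
      filter_upwards [h0, ae_restrict_mem measurableSet_Ioo] with t ht hmem
      have : t - a = 0 := RCLike.ofReal_eq_zero.1 ht
      linarith [hmem.1]
    rw [ae_iff] at this
    simp [hμ, not_le.2 hab] at this
  set α := (eLpNorm τ q μ).toNNReal with hα
  set β := (eLpNorm (fun _ : ℝ => (1 : 𝕜)) q μ).toNNReal with hβ
  have eα : eLpNorm τ q μ = α := (ENNReal.coe_toNNReal hτ.2.ne).symm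
  have eβ : eLpNorm (fun _ : ℝ => (1 : 𝕜)) q μ = β := (ENNReal.coe_toNNReal h1.2.ne).symm
  have hαpos : (0 : ℝ) < α := by
    rw [NNReal.coe_pos, pos_iff_ne_zero]
    intro h
    rw [eα, h] at hα0
    exact hα0 rfl
  -- The function (t - a)x solves the problem with data x + (t - a)A₀x; α and β are the L^q norms of
  -- t - a and of 1.
  have key : ∀ x : D, α * ‖x‖ ≤ K * (β * ‖ι x‖ + α * ‖A₀ x‖) := by
    intro x
    have hm1 := memLp_smul_const (ι x) h1
    have hm2 := memLp_smul_const (A₀ x) hτ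
    have hsol : MildSolution a b q ι (fun _ => A₀)
        ((fun _ => (1 : 𝕜) • ι x) + fun t => τ t • A₀ x) (fun t => τ t • x)
        (fun _ => (1 : 𝕜) • ι x) := by
      refine ⟨memLp_smul_const x hτ, hm1, ae_of_all _ fun t => ?_, ae_of_all _ fun t => ?_⟩
      · rw [map_smul, intervalIntegral.integral_const, one_smul]
        exact (RCLike.real_smul_eq_coe_smul (K := 𝕜) (t - a) (ι x)).symm
      · simp
    have h2 := (hS.bound _ _ _ (hm1.add hm2) hsol).trans
      (mul_le_mul_right (eLpNorm_add_le hm1.1 hm2.1 hq) _)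
    rw [eLpNorm_smul_const, eLpNorm_smul_const, eLpNorm_smul_const, eα, eβ] at h2
    simp only [enorm_eq_nnnorm] at h2
    norm_cast at h2
    rw [← NNReal.coe_le_coe] at h2
    push_cast at h2
    linarith
  have hpos : (0 : ℝ) < K * (α + β) + 1 := by positivity
  refine ⟨α / (K * (α + β) + 1), ‖ι‖ + ‖A₀‖ + 1, by positivity, by positivity,
    fun x => ⟨?_, ?_⟩⟩
  · rw [div_mul_eq_mul_div, div_le_iff₀ hpos]
    refine (key x).trans ?_
    have e1 : (β : ℝ) * ‖ι x‖ ≤ (α + β) * ‖ι x‖ := by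
      gcongr; linarith
    have e2 : (α : ℝ) * ‖A₀ x‖ ≤ (α + β) * ‖A₀ x‖ := by
      gcongr; linarith [β.coe_nonneg]
    have e3 : (K : ℝ) * (β * ‖ι x‖ + α * ‖A₀ x‖) ≤
        K * ((α + β) * ‖ι x‖ + (α + β) * ‖A₀ x‖) := by gcongr
    linarith [norm_nonneg (ι x), norm_nonneg (A₀ x)]
  · linarith [ι.le_opNorm x, A₀.le_opNorm x, norm_nonneg x]

end Correspondence

/-! ### Freezing coefficients and uniform solvability on the whole interval -/

section UniformSolvability

variable {𝕜 D X κ : Type*} [RCLike 𝕜]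
  [NormedAddCommGroup D] [NormedSpace 𝕜 D]
  [NormedAddCommGroup X] [NormedSpace ℝ X] [NormedSpace 𝕜 X] [CompleteSpace X]
  {a b : ℝ} {q : ℝ≥0∞} {ι : D →L[𝕜] X} {S : Set κ} {A : κ → ℝ → D →L[𝕜] X}

/-- Near every point, a relatively equicontinuous family is uniformly solvable if the autonomous
problems at that point are. -/
theorem exists_ball_mildSolvable (hq : 1 ≤ q) {s : ℝ} (hs : s ∈ Icc a b)
    (hmeas : ∀ l ∈ S, ∀ x, AEStronglyMeasurable (fun t => A l t x) (volume.restrict (Ioo a b)))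
    (hrel : ∀ ε > 0, ∃ δ > 0, ∃ η ≥ 0, ∀ l ∈ S, RelContEstimate a b ι (A l) ε δ η)
    {K M : ℝ≥0} (hpt : ∀ l ∈ S, MildSolvable a b q ι (fun _ => A l s) K ∧ ‖A l s‖ ≤ M) :
    ∃ r > 0, ∃ K M : ℝ≥0, ∀ c d, a ≤ c → c ≤ d → d ≤ b → Icc c d ⊆ Metric.ball s r →
      ∀ l ∈ S, MildSolvable c d q ι (A l) K ∧ ∀ t ∈ Icc c d, ‖A l t‖ ≤ M := by
  -- First ε is fixed so that εK ≤ 1/4; this determines δ and η. Then h is chosen so that ηh(1 + MK)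
  -- ≤ 1/4, and the two add up to the 1/2 required for the perturbation.
  let ε : ℝ≥0 := 1 / (4 * (K + 1))
  have hε : 0 < ε := by positivity
  obtain ⟨δ, hδ, η', hη', hest⟩ := hrel ε (by exact_mod_cast hε)
  lift η' to ℝ≥0 using hη' with η
  let h : ℝ≥0 := 1 / (4 * (η + 1) * (1 + M * K))
  have hh : 0 < h := by positivity
  have hsmall : ε * K + η * (h * (1 + M * K)) ≤ 1 / 2 := by
    rw [← NNReal.coe_le_coe]
    have e1 : (ε * K : ℝ) ≤ 1 / 4 := by
      simp only [ε]
      push_cast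
      rw [div_mul_eq_mul_div, div_le_div_iff₀ (by positivity) (by positivity)]
      linarith
    have e2 : (η * (h * (1 + M * K)) : ℝ) ≤ 1 / 4 := by
      have : (η * (h * (1 + M * K)) : ℝ) = η / (4 * (η + 1)) := by
        simp only [h]
        push_cast
        have : (0 : ℝ) < 1 + M * K := by positivity
        field_simp
      rw [this, div_le_div_iff₀ (by positivity) (by positivity)]
      linarith
    push_cast
    linarith
  -- Radius δ gives relative continuity with respect to s; radius h/2 keeps the intervals in the
  -- ball no longer than h.
  refine ⟨min δ (h / 2), lt_min hδ (by positivity), 2 * K, M + (ε + η * ‖ι‖₊),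
    fun c d hac hcd hdb hball l hl => ?_⟩
  have hnear : ∀ t ∈ Icc c d, |t - s| < min δ (h / 2) := fun t ht => by
    simpa [Real.dist_eq] using hball ht
  have hAB : ∀ t ∈ Icc c d, ∀ x, ‖A l t x - A l s x‖ ≤ ε * ‖x‖ + η * ‖ι x‖ := fun t ht x =>
    hest l hl x t ⟨hac.trans ht.1, ht.2.trans hdb⟩ s hs ((hnear t ht).le.trans (min_le_left _ _))
  obtain ⟨hS, hM⟩ := hpt l hl
  have hlen : d - c ≤ h := by
    have h1 := (abs_lt.1 ((hnear c ⟨le_rfl, hcd⟩).trans_le (min_le_right _ _))).1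
    have h2 := (abs_lt.1 ((hnear d ⟨hcd, le_rfl⟩).trans_le (min_le_right _ _))).2
    linarith
  have hle : volume.restrict (Ioo c d) ≤ volume.restrict (Ioo a b) :=
    Measure.restrict_mono (Ioo_subset_Ioo hac hdb) le_rfl
  refine ⟨(hS.subinterval hac hcd hdb).perturb hq (fun x => aestronglyMeasurable_const)
    (fun x => (hmeas l hl x).mono_measure hle) (fun _ _ => hM)
    (fun t ht => hAB t (Ioo_subset_Icc_self ht)) hlen hsmall, fun t ht => ?_⟩
  refine ContinuousLinearMap.opNorm_le_bound _ (NNReal.coe_nonneg _) fun x => ?_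
  have h1 := hAB t ht x
  have h2 := (A l s).le_of_opNorm_le hM x
  have h3 := norm_le_norm_add_norm_sub (A l s x) (A l t x)
  have h4 : (η : ℝ) * ‖ι x‖ ≤ η * (‖ι‖ * ‖x‖) := by gcongr; exact ι.le_opNorm x
  rw [norm_sub_rev] at h3
  push_cast
  linarith

/-- A relatively equicontinuous family is uniformly solvable if the autonomous problems at all
points are solvable, uniformly in the family. -/
theorem exists_uniform_mildSolvable (hq : 1 ≤ q) (hab : a < b)
    (hmeas : ∀ l ∈ S, ∀ x, AEStronglyMeasurable (fun t => A l t x) (volume.restrict (Ioo a b)))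
    (hrel : ∀ ε > 0, ∃ δ > 0, ∃ η ≥ 0, ∀ l ∈ S, RelContEstimate a b ι (A l) ε δ η)
    (hpt : ∀ t ∈ Icc a b, ∃ K M : ℝ≥0, ∀ l ∈ S,
      MildSolvable a b q ι (fun _ => A l t) K ∧ ‖A l t‖ ≤ M) :
    ∃ K M : ℝ≥0, ∀ l ∈ S, MildSolvable a b q ι (A l) K ∧ ∀ t ∈ Icc a b, ‖A l t‖ ≤ M := by
  have hloc : ∀ s : Icc a b, ∃ r > 0, ∃ K M : ℝ≥0, ∀ c d, a ≤ c → c ≤ d → d ≤ b →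
      Icc c d ⊆ Metric.ball (s : ℝ) r →
      ∀ l ∈ S, MildSolvable c d q ι (A l) K ∧ ∀ t ∈ Icc c d, ‖A l t‖ ≤ M := fun s => by
    obtain ⟨K, M, h⟩ := hpt s s.2
    exact exists_ball_mildSolvable hq s.2 hmeas hrel h
  choose r hr K M hKM using hloc
  obtain ⟨δ, hδ, hleb⟩ := lebesgue_number_lemma_of_metric (isCompact_Icc (a := a) (b := b))
    (c := fun s : Icc a b => Metric.ball (s : ℝ) (r s)) (fun s => Metric.isOpen_ball)
    (fun t ht => mem_iUnion.2 ⟨⟨t, ht⟩, Metric.mem_ball_self (hr _)⟩)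
  -- Equal pieces, shorter than the Lebesgue number, each lie in one ball. Their equal length also
  -- serves the gluing.
  obtain ⟨n, hn⟩ := exists_nat_gt ((b - a) / δ)
  have hn0 : (0 : ℝ) < n := (div_pos (sub_pos.2 hab) hδ).trans hn
  set h := (b - a) / n with hh
  have hhpos : 0 < h := div_pos (sub_pos.2 hab) hn0
  have hhδ : h < δ := by
    rw [div_lt_iff₀ hδ] at hn
    rw [hh, div_lt_iff₀ hn0]
    linarith
  have hnh : a + n * h = b := by
    rw [hh]
    field_simp
    ring
  have hstep : ∀ i : ℕ, i < n → ∃ K M : ℝ≥0, ∀ l ∈ S,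
      MildSolvable (a + i * h) (a + (i + 1 : ℕ) * h) q ι (A l) K ∧
      ∀ t ∈ Icc (a + i * h) (a + (i + 1 : ℕ) * h), ‖A l t‖ ≤ M := by
    intro i hi
    have hin : ((i + 1 : ℕ) : ℝ) * h ≤ n * h := by gcongr; omega
    have hih : 0 ≤ (i : ℝ) * h := by positivity
    push_cast at hin
    obtain ⟨s, hs⟩ := hleb (a + i * h) ⟨by linarith, by linarith⟩
    refine ⟨K s, M s, hKM s _ _ (by linarith) (by push_cast; linarith) (by push_cast; linarith)
      (Subset.trans (fun t ht => ?_) hs)⟩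
    rw [Metric.mem_ball, Real.dist_eq, abs_of_nonneg (sub_nonneg.2 ht.1)]
    have := ht.2
    push_cast at this
    linarith
  -- The induction starts at i = 1: reflection needs the interval already solved, of length ih, to
  -- be at least as long as the next piece.
  have hind : ∀ i : ℕ, 1 ≤ i → i ≤ n → ∃ K M : ℝ≥0, ∀ l ∈ S,
      MildSolvable a (a + i * h) q ι (A l) K ∧ ∀ t ∈ Icc a (a + i * h), ‖A l t‖ ≤ M := by
    intro i hi
    induction i, hi using Nat.le_induction with
    | base =>
      intro hn1
      obtain ⟨K, M, hl⟩ := hstep 0 hn1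
      refine ⟨K, M, ?_⟩
      simpa using hl
    | succ i hi ih =>
      intro hin
      obtain ⟨K₁, M₁, h₁⟩ := ih (by omega)
      obtain ⟨K₂, M₂, h₂⟩ := hstep i (by omega)
      refine ⟨2 * K₁ + K₂ * (2 + 2 * max M₁ M₂ * K₁), max M₁ M₂, fun l hl => ?_⟩
      have hin' : ((i + 1 : ℕ) : ℝ) * h ≤ n * h := by gcongr
      have hi' : h ≤ i * h := le_mul_of_one_le_left hhpos.le (by exact_mod_cast hi)
      have hM : ∀ t ∈ Icc a (a + (i + 1 : ℕ) * h), ‖A l t‖ ≤ max M₁ M₂ := fun t ht => by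
        rcases le_total t (a + i * h) with hle | hle
        · exact ((h₁ l hl).2 t ⟨ht.1, hle⟩).trans (le_max_left _ _)
        · exact ((h₂ l hl).2 t ⟨hle, ht.2⟩).trans (le_max_right _ _)
      have hle : volume.restrict (Ioo a (a + (i + 1 : ℕ) * h)) ≤ volume.restrict (Ioo a b) :=
        Measure.restrict_mono (Ioo_subset_Ioo_right (by linarith)) le_rfl
      exact ⟨(h₁ l hl).1.glue hq (M := max M₁ M₂) (by push_cast; linarith)
        (by push_cast; linarith) (fun x => (hmeas l hl x).mono_measure hle)
        (fun t ht => hM t (Ioo_subset_Icc_self ht)) (h₂ l hl).1, hM⟩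
  have := hind n (by exact_mod_cast hn0) le_rfl
  rwa [hnh] at this

end UniformSolvability

/-! ### Passing to the limit parameter -/

section Limits

variable {𝕜 D X Λ : Type*} [RCLike 𝕜]
  [NormedAddCommGroup D] [NormedSpace 𝕜 D]
  [NormedAddCommGroup X] [NormedSpace ℝ X] [NormedSpace 𝕜 X] [CompleteSpace X]
  [MetricSpace Λ] {a b : ℝ} {q : ℝ≥0∞} {ι : D →L[𝕜] X} {O : Set Λ}
  {A : Λ → ℝ → D →L[𝕜] X} {lbar : Λ}

/-- Uniform solvability of autonomous problems passes to limits in operator norm. -/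
theorem exists_mildSolvable_insert (hq : 1 ≤ q) {t : ℝ} (hlbar : lbar ∈ closure O)
    (hconv : Tendsto (fun l => A l t) (𝓝[O] lbar) (𝓝 (A lbar t))) {K M : ℝ≥0}
    (h : ∀ l ∈ O, MildSolvable a b q ι (fun _ => A l t) K ∧ ‖A l t‖ ≤ M) :
    ∃ K M : ℝ≥0, ∀ l ∈ insert lbar O,
      MildSolvable a b q ι (fun _ => A l t) K ∧ ‖A l t‖ ≤ M := by
  have : (𝓝[O] lbar).NeBot := mem_closure_iff_nhdsWithin_neBot.1 hlbar
  refine ⟨2 * K, M, ?_⟩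
  rintro l (rfl | hl)
  · let ε : ℝ≥0 := 1 / (2 * (K + 1))
    have hε : 0 < ε := by positivity
    have hεK : ε * K ≤ 1 / 2 := by
      rw [← NNReal.coe_le_coe]
      simp only [ε]
      push_cast
      rw [div_mul_eq_mul_div, div_le_div_iff₀ (by positivity) (by positivity)]
      linarith
    -- One operator of the family within ε of the limit suffices. The perturbation is small in L(D;
    -- X), so η = 0 and the interval need not be short.
    obtain ⟨m, hm, hmO⟩ := ((hconv.eventually (Metric.ball_mem_nhds _
      (show (0 : ℝ) < ε from hε))).and self_mem_nhdsWithin).exists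
    refine ⟨(h m hmO).1.perturb hq (M := M) (ε := ε) (η := 0) (h := (b - a).toNNReal)
      (fun _ => aestronglyMeasurable_const) (fun _ => aestronglyMeasurable_const)
      (fun _ _ => (h m hmO).2) (fun _ _ x => ?_) (Real.le_coe_toNNReal _) (by simpa using hεK),
      le_of_tendsto hconv.norm ?_⟩
    · have h1 : ‖A l t - A m t‖ ≤ ε := by
        rw [← dist_eq_norm, dist_comm]
        exact (Metric.mem_ball.1 hm).le
      simpa using (A l t - A m t).le_of_opNorm_le h1 x
    · filter_upwards [self_mem_nhdsWithin] with m hm using (h m hm).2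
  · exact ⟨(h l hl).1.mono (le_mul_of_one_le_left (zero_le) one_le_two), (h l hl).2⟩

end Limits

end MaxReg

/-! ### The main theorem -/

open MaxReg

theorem mainTheorem10 {𝕜 D X Λ : Type*} [RCLike 𝕜]
    [NormedAddCommGroup D] [NormedSpace 𝕜 D] [CompleteSpace D]
    [NormedAddCommGroup X] [NormedSpace ℝ X] [NormedSpace 𝕜 X] [IsScalarTower ℝ 𝕜 X]
    [CompleteSpace X] [MetricSpace Λ]
    (ι : D →L[𝕜] X) (hι_inj : Function.Injective ι) (hι_dense : DenseRange ι)
    (hι_compact : IsCompactOperator ι)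
    (p : ℝ) (hp : 1 < p) (a b : ℝ) (hab : a < b)
    (O : Set Λ) (hO : IsOpen O) (A : Λ → ℝ → D →L[𝕜] X)
    (hA : MaxReg.FamilyAssumption a b p ι O A)
    (lbar : Λ) (hlbar : lbar ∈ closure O)
    (hconv : ∀ t ∈ Icc a b, Tendsto (fun l => A l t) (𝓝[O] lbar) (𝓝 (A lbar t))) :
    (∀ l ∈ O, MaxReg.NonautMaxReg (Ioo a b) a p ι (A l)) ∧
    MaxReg.NonautMaxReg (Ioo a b) a p ι (A lbar) ∧
    ∀ f : Λ → ℝ → X,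
      (∀ l ∈ insert lbar O, MemLp (f l) (ENNReal.ofReal p) (volume.restrict (Ioo a b))) →
      Tendsto (fun l => eLpNorm (f l - f lbar) (ENNReal.ofReal p) (volume.restrict (Ioo a b)))
        (𝓝[O] lbar) (𝓝 0) →
      ∀ v : Λ → ℝ → D,
        (∀ l ∈ insert lbar O, MaxReg.IsSolution (Ioo a b) a p ι (A l) (f l) (v l)) →
        Tendsto (fun l => MaxReg.mrNorm (Ioo a b) p ι (v l - v lbar)) (𝓝[O] lbar) (𝓝 0) := by
  have hq : 1 ≤ ENNReal.ofReal p := by simpa using hp.le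
  have hNeBot : (𝓝[O] lbar).NeBot := mem_closure_iff_nhdsWithin_neBot.1 hlbar
  have hconvx : ∀ t ∈ Icc a b, ∀ x, Tendsto (fun l => A l t x) (𝓝[O] lbar) (𝓝 (A lbar t x)) :=
    fun t ht x => ((ContinuousLinearMap.apply 𝕜 X x).continuous.tendsto _).comp (hconv t ht)
  have hmeas : ∀ l ∈ insert lbar O, ∀ x,
      AEStronglyMeasurable (fun t => A l t x) (volume.restrict (Ioo a b)) := by
    have hmO : ∀ l ∈ O, ∀ x,
        AEStronglyMeasurable (fun t => A l t x) (volume.restrict (Ioo a b)) := fun l hl =>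
      (hA.equicont.1 _ (mem_image_of_mem A hl)).1
    rintro l (rfl | hl) x
    · obtain ⟨u, hu, hul⟩ := mem_closure_iff_seq_limit.1 hlbar
      refine aestronglyMeasurable_of_tendsto_ae atTop (f := fun n t => A (u n) t x)
        (fun n => hmO _ (hu n) x) ?_
      filter_upwards [ae_restrict_mem measurableSet_Ioo] with t ht
      exact (hconvx t (Ioo_subset_Icc_self ht) x).comp
        (tendsto_nhdsWithin_iff.2 ⟨hul, Eventually.of_forall hu⟩)
    · exact hmO l hl x
  have hrel : ∀ ε > 0, ∃ δ > 0, ∃ η ≥ 0, ∀ l ∈ insert lbar O,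
      RelContEstimate a b ι (A l) ε δ η := by
    intro ε hε
    obtain ⟨δ, hδ, η, hη, h⟩ := hA.equicont.2 ε hε
    refine ⟨δ, hδ, η, hη, ?_⟩
    have hOest : ∀ l ∈ O, RelContEstimate a b ι (A l) ε δ η := fun l hl =>
      h _ (mem_image_of_mem A hl)
    rintro l (rfl | hl)
    · intro x t ht s hs hts
      -- The estimate is a closed condition for fixed t, s, x, so the limit operator satisfies it
      -- with the same δ and η.
      refine le_of_tendsto ((hconvx t ht x).sub (hconvx s hs x)).norm ?_
      filter_upwards [self_mem_nhdsWithin] with m hm using hOest m hm x t ht s hs hts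
    · exact hOest l hl
  have hpt : ∀ t ∈ Icc a b, ∃ K M : ℝ≥0, ∀ l ∈ insert lbar O,
      MildSolvable a b (ENNReal.ofReal p) ι (fun _ => A l t) K ∧ ‖A l t‖ ≤ M := by
    intro t ht
    obtain ⟨C, hC⟩ := hA.bdd t ht
    obtain ⟨K, hK⟩ := ENNReal.lt_iff_exists_nnreal_btwn.1 (hA.const_bdd t ht)
    refine exists_mildSolvable_insert hq (K := K) (M := C.toNNReal) hlbar (hconv t ht)
      fun l hl => ⟨?_, (hC l hl).trans (Real.le_coe_toNNReal C)⟩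
    -- K lies strictly above the supremum, hence above an admissible constant of each member of the
    -- family.
    have h1 : autMRConst (Ioo a b) a p ι (A l t) < K :=
      (le_iSup₂ (f := fun l (_ : l ∈ O) => autMRConst (Ioo a b) a p ι (A l t)) l hl).trans_lt hK.1
    obtain ⟨K', hK'⟩ := iInf_lt_iff.1 h1
    obtain ⟨hs, hlt⟩ := iInf_lt_iff.1 hK'
    exact (hs.mildSolvable hp.le hab).mono (by exact_mod_cast hlt.le)
  obtain ⟨K, M, hKM⟩ := exists_uniform_mildSolvable hq hab hmeas hrel hpt
  have hM : ∀ l ∈ insert lbar O, ∀ t ∈ Ioo a b, ‖A l t‖ ≤ M := fun l hl t ht =>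
    (hKM l hl).2 t (Ioo_subset_Icc_self ht)
  have hmax : ∀ l ∈ insert lbar O, NonautMaxReg (Ioo a b) a p ι (A l) := by
    intro l hl
    refine ⟨fun x => ?_, fun t ht => ?_, _,
      (hKM l hl).1.solvableWith hp.le hab (hmeas l hl) (hM l hl)⟩
    · refine memLp_top_of_bound (hmeas l hl x) (M * ‖x‖) ?_
      filter_upwards [ae_restrict_mem measurableSet_Ioo] with t ht
      exact (A l t).le_of_opNorm_le (hM l hl t ht) x
    · obtain ⟨K', M', h'⟩ := hpt t (Ioo_subset_Icc_self ht)
      exact (h' l hl).1.graphNormEquiv hq hab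
  refine ⟨fun l hl => hmax l (mem_insert_of_mem _ hl), hmax _ (mem_insert _ _), ?_⟩
  intro f hf hflim v hv
  have hb : lbar ∈ insert lbar O := mem_insert _ _
  have hMae : ∀ l ∈ insert lbar O, ∀ᵐ t ∂(volume.restrict (Ioo a b)), ‖A l t‖ ≤ M :=
    fun l hl => (ae_restrict_mem measurableSet_Ioo).mono (hM l hl)
  obtain ⟨wbar, hwbar⟩ := (isSolution_iff_exists_mildSolution hp.le hab).1 (hv _ hb)
  have hdiff := tendsto_eLpNorm_clm_apply_sub (q := ENNReal.ofReal p) (by positivity)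
    ENNReal.ofReal_ne_top hmeas hMae ((ae_restrict_mem measurableSet_Ioo).mono fun t ht =>
      hconv t (Ioo_subset_Icc_self ht)) hwbar.memLp
  have hlim := ENNReal.Tendsto.const_mul
    (a := ((‖ι‖₊ * K + K + (b - a).toNNReal * (1 + M * K) : ℝ≥0) : ℝ≥0∞))
    (hflim.add hdiff) (Or.inr ENNReal.coe_ne_top)
  rw [add_zero, mul_zero] at hlim
  refine tendsto_of_tendsto_of_tendsto_of_le_of_le' tendsto_const_nhds hlim
    (Eventually.of_forall fun _ => zero_le) ?_
  filter_upwards [self_mem_nhdsWithin] with l hl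
  have hl' : l ∈ insert lbar O := mem_insert_of_mem _ hl
  obtain ⟨w, hw⟩ := (isSolution_iff_exists_mildSolution hp.le hab).1 (hv l hl')
  have hdm : MemLp (fun t => A l t (v lbar t) - A lbar t (v lbar t)) (ENNReal.ofReal p)
      (volume.restrict (Ioo a b)) :=
    (memLp_clm_apply (hmeas l hl') (hMae l hl') hwbar.memLp).sub
      (memLp_clm_apply (hmeas _ hb) (hMae _ hb) hwbar.memLp)
  -- Viewed as a solution for `A l`, the fixed function `v lbar` has data f_λ̄ + (A_λ - A_λ̄)v_λ̄.
  -- The estimate for the difference thus uses the uniform constant of `A l`.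
  have hsub := hw.sub hq (hwbar.change_operator (A l))
  refine (hsub.mrNorm_le hp.le (hmeas l hl') (hM l hl') (hKM l hl').1
    ((hf l hl').sub ((hf _ hb).add hdm))).trans ?_
  gcongr
  rw [← sub_sub]
  exact eLpNorm_sub_le ((hf l hl').sub (hf _ hb)).1 hdm.1 hq
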